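/- Let $l\ge 1$ and let $\mathfrak g=\mathfrak g_0\oplus\mathfrak g_1=\mathfrak{osp}(1,2l)$ be the complex orthosymplectic Lie superalgebra, so $\mathfrak g_0\cong\mathfrak{sp}(2l)$. Let $\mathfrak h$ be a Cartan subalgebra of $\mathfrak g_0$, let $\Delta$ be the set of (even and odd) roots of $\mathfrak g$ with respect to $\mathfrak h$, let $\pi$ be a basis of simple roots of $\Delta$, let $\Delta^+=\Delta\cap\mathbb N\pi$, $\mathfrak n^+=\bigoplus_{\alpha\in\Delta^+}\mathfrak g_\alpha$ and $\mathfrak b^+=\mathfrak h\oplus\mathfrak n^+$. Let $\mathcal U(\mathfrak g)$ be the universal enveloping algebra of $\mathfrak g$, on which $\mathfrak g$ acts by the adjoint action $\operatorname{ad}$, i.e. by superderivations: $(\operatorname{ad}x)(u)=xu-(-1)^{|x||u|}ux$ for homogeneous $x\in\mathfrak g$, $u\in\mathcal U(\mathfrak g)$. For $\lambda\in\mathfrak h^*$ let $\widetilde M(\lambda)=\mathcal U(\mathfrak g)\otimes_{\mathcal U(\mathfrak b^+)}\mathbb C_\lambda$ be the Verma module, where $\mathbb C_\lambda$ is the one-dimensional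 $\mathfrak b^+$-module on which $\mathfrak n^+$ acts by $0$ and each $H\in\mathfrak h$ acts by $\lambda(H)$; equivalently, $\widetilde M(\lambda)$ is the quotient of $\mathcal U(\mathfrak g)$ by the left ideal generated by $\mathfrak n^+$ and the elements $H-\lambda(H)$, $H\in\mathfrak h$. Let $V$ be an $\operatorname{ad}$-invariant linear subspace of $\mathcal U(\mathfrak g)$. Then the set $$\{\lambda\in\mathfrak h^* \;:\; V\subset \operatorname{Ann}_{\mathcal U(\mathfrak g)}\widetilde M(\lambda)\}$$ is a Zariski closed subset of $\mathfrak h^*$, i.e. the set of common zeros of a set of polynomial functions on $\mathfrak h^*$. -/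

import Mathlib

open scoped DirectSum

attribute [local instance 100] LieRing.ofAssociativeRing

noncomputable section

namespace Osp

/-- The index set of the standard basis of `ℂ^{1|2l}`: one even and `2l` odd basis vectors. -/
abbrev Idx (l : ℕ) : Type := Unit ⊕ (Fin l ⊕ Fin l)

/-- Endomorphisms of `ℂ^{1|2l}`. -/
abbrev Mat (l : ℕ) : Type := Matrix (Idx l) (Idx l) ℂ

/-- The parity of a basis vector. -/
def parity (l : ℕ) : Idx l → ZMod 2 := Sum.elim (fun _ => 0) (fun _ => 1)

/-- The sign `(-1)^{pq}`. -/
def sgn (p q : ZMod 2) : ℂ := if p = 1 ∧ q = 1 then -1 else 1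

/-- The Gram matrix of the standard nondegenerate even supersymmetric bilinear form `F` on
`ℂ^{1|2l}`: symmetric on the even line, symplectic on the odd part `ℂ^{2l}`. -/
def form (l : ℕ) : Mat l := Matrix.fromBlocks 1 0 0 (Matrix.J (Fin l) ℂ)

/-- The homogeneous part of parity `p` of `osp(1,2l)`: the matrices `X` of parity `p` with
`F(X v, w) + (-1)^{p |v|} F(v, X w) = 0` for all homogeneous `v`, `w`
(written out for basis vectors). -/
def part (l : ℕ) (p : ZMod 2) : Submodule ℂ (Mat l) where
  carrier := {X | (∀ i j, X i j ≠ 0 → parity l i = parity l j + p) ∧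
    ∀ i j, (X.transpose * form l) i j + sgn p (parity l i) * (form l * X) i j = 0}
  zero_mem' := by simp
  add_mem' := by
    rintro X Y ⟨hX, hX'⟩ ⟨hY, hY'⟩
    refine ⟨fun i j hij => ?_, fun i j => ?_⟩
    · by_cases h : X i j = 0
      · refine hY i j fun h' => hij ?_
        simp [h, h']
      · exact hX i j h
    · have h1 := hX' i j
      have h2 := hY' i j
      simp only [Matrix.transpose_add, add_mul, mul_add, Matrix.add_apply]
      linear_combination h1 + h2
  smul_mem' := by
    rintro c X ⟨hX, hX'⟩
    refine ⟨fun i j hij => hX i j fun h => hij (by simp [h]), fun i j => ?_⟩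
    have h1 := hX' i j
    simp only [Matrix.transpose_smul, Matrix.smul_mul, Matrix.mul_smul, Matrix.smul_apply,
      smul_eq_mul]
    linear_combination c * h1

theorem sgn_add_left (p q r : ZMod 2) : sgn (p + q) r = sgn p r * sgn q r := by
  have h : ∀ p q r : ZMod 2, (p = 1 ∧ r = 1) ∧ (q = 1 ∧ r = 1) ∧ ¬ (p + q = 1 ∧ r = 1) ∨
      (p = 1 ∧ r = 1) ∧ ¬ (q = 1 ∧ r = 1) ∧ (p + q = 1 ∧ r = 1) ∨
      ¬ (p = 1 ∧ r = 1) ∧ (q = 1 ∧ r = 1) ∧ (p + q = 1 ∧ r = 1) ∨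
      ¬ (p = 1 ∧ r = 1) ∧ ¬ (q = 1 ∧ r = 1) ∧ ¬ (p + q = 1 ∧ r = 1) := by decide
  unfold sgn
  rcases h p q r with ⟨h1, h2, h3⟩ | ⟨h1, h2, h3⟩ | ⟨h1, h2, h3⟩ | ⟨h1, h2, h3⟩
  · rw [if_pos h1, if_pos h2, if_neg h3]; norm_num
  · rw [if_pos h1, if_neg h2, if_pos h3]; norm_num
  · rw [if_neg h1, if_pos h2, if_pos h3]; norm_num
  · rw [if_neg h1, if_neg h2, if_neg h3]; norm_num

theorem sgn_comm (p q : ZMod 2) : sgn p q = sgn q p := by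
  unfold sgn; simp only [and_comm]

theorem sgn_add_right (p q r : ZMod 2) : sgn p (q + r) = sgn p q * sgn p r := by
  rw [sgn_comm, sgn_add_left, sgn_comm q, sgn_comm r]

theorem sgn_mul_self (p q : ZMod 2) : sgn p q * sgn p q = 1 := by
  unfold sgn; split_ifs <;> simp

theorem mul_parity {l : ℕ} {p q : ZMod 2} {X Y : Mat l}
    (hX : ∀ i j, X i j ≠ 0 → parity l i = parity l j + p)
    (hY : ∀ i j, Y i j ≠ 0 → parity l i = parity l j + q) (i j : Idx l)
    (h : (X * Y) i j ≠ 0) : parity l i = parity l j + (p + q) := by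
  rw [Matrix.mul_apply] at h
  obtain ⟨k, -, hk⟩ := Finset.exists_ne_zero_of_sum_ne_zero h
  rw [hX i k (left_ne_zero_of_mul hk), hY k j (right_ne_zero_of_mul hk)]
  ring

theorem mul_form_aux {l : ℕ} {p q : ZMod 2} {X Y : Mat l} (hX : X ∈ part l p)
    (hY : Y ∈ part l q) (i j : Idx l) :
    ((X * Y).transpose * form l) i j =
      sgn p q * sgn (p + q) (parity l i) * (form l * (Y * X)) i j := by
  have e1 : ∀ k, (X.transpose * form l) k j = -(sgn p (parity l k) * (form l * X) k j) :=
    fun k => by linear_combination hX.2 k j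
  have e2 : ∀ k, (Y.transpose * form l) i k = -(sgn q (parity l i) * (form l * Y) i k) :=
    fun k => by linear_combination hY.2 i k
  have e3 : ∀ k, Y.transpose i k * sgn p (parity l k) =
      Y.transpose i k * (sgn p (parity l i) * sgn p q) := by
    intro k
    by_cases h : Y k i = 0
    · simp [Matrix.transpose_apply, h]
    · rw [hY.1 k i h, sgn_add_right]
  calc ((X * Y).transpose * form l) i j
      = (Y.transpose * (X.transpose * form l)) i j := by
        rw [Matrix.transpose_mul, Matrix.mul_assoc]
    _ = ∑ k, Y.transpose i k * (X.transpose * form l) k j := Matrix.mul_apply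
    _ = ∑ k, -(sgn p (parity l i) * sgn p q) * (Y.transpose i k * (form l * X) k j) := by
        refine Finset.sum_congr rfl fun k _ => ?_
        rw [e1]
        linear_combination -(form l * X) k j * e3 k
    _ = -(sgn p (parity l i) * sgn p q) * ((Y.transpose * form l) * X) i j := by
        rw [← Finset.mul_sum, ← Matrix.mul_apply, Matrix.mul_assoc]
    _ = -(sgn p (parity l i) * sgn p q) *
          ∑ k, -(sgn q (parity l i) * (form l * Y) i k) * X k j := by
        rw [Matrix.mul_apply]
        simp only [e2]
    _ = sgn p q * sgn (p + q) (parity l i) * ((form l * Y) * X) i j := by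
        rw [Matrix.mul_apply, Finset.mul_sum, Finset.mul_sum, sgn_add_left]
        refine Finset.sum_congr rfl fun k _ => ?_
        ring
    _ = _ := by rw [Matrix.mul_assoc]

theorem bracket_mem {l : ℕ} {p q : ZMod 2} {X Y : Mat l} (hX : X ∈ part l p)
    (hY : Y ∈ part l q) : X * Y - sgn p q • (Y * X) ∈ part l (p + q) := by
  refine ⟨fun i j h => ?_, fun i j => ?_⟩
  · by_cases h1 : (X * Y) i j = 0
    · have h2 : (Y * X) i j ≠ 0 := fun h2 => h (by simp [h1, h2])
      rw [mul_parity hY.1 hX.1 i j h2, add_comm q p]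
    · exact mul_parity hX.1 hY.1 i j h1
  · have h1 := mul_form_aux hX hY i j
    have h2 := mul_form_aux hY hX i j
    rw [add_comm q p, sgn_comm q p] at h2
    have h3 := sgn_mul_self p q
    simp only [Matrix.transpose_sub, Matrix.transpose_smul, sub_mul, mul_sub, Matrix.smul_mul,
      Matrix.mul_smul, Matrix.sub_apply, Matrix.smul_apply, smul_eq_mul]
    linear_combination h1 - sgn p q * h2 -
      sgn (p + q) (parity l i) * (form l * (X * Y)) i j * h3

/-- The superbracket `[x, y] = x y - (-1)^{pq} y x` of homogeneous elements of `osp(1,2l)`. -/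
def bracket {l : ℕ} {p q : ZMod 2} (x : part l p) (y : part l q) : part l (p + q) :=
  ⟨(x : Mat l) * y - sgn p q • ((y : Mat l) * x), bracket_mem x.2 y.2⟩

/-- The space `osp(1,2l) = osp(1,2l)_0 ⊕ osp(1,2l)_1`. -/
abbrev Alg (l : ℕ) : Type := ⨁ p : ZMod 2, part l p

/-- The defining relations `x y = (-1)^{pq} y x + [x, y]` of the enveloping algebra. -/
inductive Rel (l : ℕ) : TensorAlgebra ℂ (Alg l) → TensorAlgebra ℂ (Alg l) → Prop
  | mk (p q : ZMod 2) (x : part l p) (y : part l q) :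
      Rel l
        (TensorAlgebra.ι ℂ (DirectSum.lof ℂ (ZMod 2) (fun r => part l r) p x) *
          TensorAlgebra.ι ℂ (DirectSum.lof ℂ (ZMod 2) (fun r => part l r) q y))
        (sgn p q • (TensorAlgebra.ι ℂ (DirectSum.lof ℂ (ZMod 2) (fun r => part l r) q y) *
            TensorAlgebra.ι ℂ (DirectSum.lof ℂ (ZMod 2) (fun r => part l r) p x)) +
          TensorAlgebra.ι ℂ (DirectSum.lof ℂ (ZMod 2) (fun r => part l r) (p + q) (bracket x y)))

/-- The universal enveloping algebra `U(osp(1,2l))` of the Lie superalgebra `osp(1,2l)`. -/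
abbrev Env (l : ℕ) : Type := RingQuot (Rel l)

/-- The canonical map from `osp(1,2l)_p` to `U(osp(1,2l))`. -/
def gen (l : ℕ) (p : ZMod 2) : part l p →ₗ[ℂ] Env l :=
  (RingQuot.mkAlgHom ℂ (Rel l)).toLinearMap ∘ₗ TensorAlgebra.ι ℂ ∘ₗ
    DirectSum.lof ℂ (ZMod 2) (fun r => part l r) p

theorem gen_mul_gen {l : ℕ} {p q : ZMod 2} (x : part l p) (y : part l q) :
    gen l p x * gen l q y = sgn p q • (gen l q y * gen l p x) + gen l (p + q) (bracket x y) := by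
  have h := RingQuot.mkAlgHom_rel ℂ (Rel.mk p q x y)
  rw [map_mul, map_add, map_smul, map_mul] at h
  exact h

/-- The parity automorphism of `U(osp(1,2l))`: it is the identity on even elements and `-1` on
odd elements. -/
def parityAut (l : ℕ) : Env l →ₐ[ℂ] Env l :=
  RingQuot.liftAlgHom ℂ ⟨TensorAlgebra.lift ℂ
    (DirectSum.toModule ℂ (ZMod 2) (Env l) fun p => sgn p 1 • gen l p), by
      rintro _ _ ⟨p, q, x, y⟩
      simp only [map_mul, map_add, map_smul, TensorAlgebra.lift_ι_apply,
        DirectSum.toModule_lof, LinearMap.smul_apply, sgn_add_left, smul_mul_smul_comm]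
      rw [gen_mul_gen x y, smul_add, smul_comm (sgn p q), mul_comm (sgn q 1)]⟩

/-- The adjoint action on `U(osp(1,2l))` of an element `x` of `osp(1,2l)_p`, that is the
superderivation `u ↦ x u - (-1)^{p |u|} u x` (for `u` homogeneous). -/
def ad {l : ℕ} {p : ZMod 2} (x : part l p) (u : Env l) : Env l :=
  gen l p x * u - (if p = 1 then parityAut l u else u) * gen l p x

/-- A subspace of `U(osp(1,2l))` that is invariant under the adjoint action. -/
def AdInvariant {l : ℕ} (V : Submodule ℂ (Env l)) : Prop :=
  ∀ (p : ZMod 2) (x : part l p), ∀ u ∈ V, ad x u ∈ V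

/-- The even part of `osp(1,2l)` as a Lie algebra (with the commutator of matrices). -/
def even (l : ℕ) : LieSubalgebra ℂ (Mat l) where
  __ := part l 0
  lie_mem' := by
    intro X Y hX hY
    have h := bracket_mem hX hY
    simpa [sgn, Ring.lie_def] using h

variable {l : ℕ}

/-- The even element of `osp(1,2l)` given by an element of a subalgebra of the even part. -/
def ofCartan {h : LieSubalgebra ℂ (even l)} (H : h) : part l 0 := ⟨((H : even l) : Mat l), H.1.2⟩

/-- The weight space `{x | [H, x] = α(H) x for all H ∈ h}` in `osp(1,2l)_p`. -/
def rootSpace (h : LieSubalgebra ℂ (even l)) (p : ZMod 2) (α : Module.Dual ℂ h) :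
    Submodule ℂ (part l p) where
  carrier := {x | ∀ H : h, ((ofCartan H : part l 0) : Mat l) * (x : Mat l) -
    (x : Mat l) * ((ofCartan H : part l 0) : Mat l) = α H • (x : Mat l)}
  zero_mem' := by simp
  add_mem' := by
    intro x y hx hy H
    have h1 := hx H
    have h2 := hy H
    simp only [Submodule.coe_add, mul_add, add_mul, smul_add]
    rw [← h1, ← h2]
    abel
  smul_mem' := by
    intro c x hx H
    have h1 := hx H
    simp only [Submodule.coe_smul, Matrix.mul_smul, Matrix.smul_mul]
    rw [← smul_sub, h1, smul_comm]

/-- The set `Δ = Δ_0 ∪ Δ_1` of (even and odd) roots of `osp(1,2l)` with respect to `h`. -/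
def roots (h : LieSubalgebra ℂ (even l)) : Set (Module.Dual ℂ h) :=
  {α | α ≠ 0 ∧ ∃ p : ZMod 2, rootSpace h p α ≠ ⊥}

/-- `π` is a basis of simple roots of `Δ`. -/
structure IsSimpleRoots (h : LieSubalgebra ℂ (even l)) (π : Set (Module.Dual ℂ h)) : Prop where
  subset_roots : π ⊆ roots h
  linearIndepOn : LinearIndepOn ℂ id π
  pos_or_neg : ∀ α ∈ roots h, α ∈ AddSubmonoid.closure π ∨ -α ∈ AddSubmonoid.closure π

/-- The set `Δ⁺ = Δ ∩ ℕπ` of positive roots. -/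
def posRoots (h : LieSubalgebra ℂ (even l)) (π : Set (Module.Dual ℂ h)) :
    Set (Module.Dual ℂ h) :=
  {α | α ∈ roots h ∧ α ∈ AddSubmonoid.closure π}

/-- The left ideal of `U(osp(1,2l))` generated by `n⁺` (the sum of the root spaces of the positive
roots) and by the elements `H - λ(H)`, `H ∈ h`. -/
def vermaIdeal (h : LieSubalgebra ℂ (even l)) (π : Set (Module.Dual ℂ h))
    (lam : Module.Dual ℂ h) : Ideal (Env l) :=
  Ideal.span ({u | ∃ α ∈ posRoots h π, ∃ p : ZMod 2, ∃ x ∈ rootSpace h p α, u = gen l p x} ∪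
    {u | ∃ H : h, u = gen l 0 (ofCartan H) - algebraMap ℂ (Env l) (lam H)})

/-- The Verma module `U(g) ⊗_{U(b⁺)} ℂ_λ` of highest weight `λ`, as the quotient of `U(g)` by the
left ideal generated by the annihilator in `U(b⁺)` of the generator of `ℂ_λ`. -/
abbrev Verma (h : LieSubalgebra ℂ (even l)) (π : Set (Module.Dual ℂ h))
    (lam : Module.Dual ℂ h) : Type :=
  Env l ⧸ vermaIdeal h π lam

/-- Zariski closed subsets of a complex vector space: the sets of common zeros of polynomial
functions, that is of polynomials in linear functionals. -/
def IsZariskiClosed {W : Type*} [AddCommGroup W] [Module ℂ W] (S : Set W) : Prop :=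
  ∃ F : Set (MvPolynomial (Module.Dual ℂ W) ℂ),
    S = {w | ∀ P ∈ F, MvPolynomial.eval (fun φ : Module.Dual ℂ W => φ w) P = 0}

end Osp

end

/-!
For an `ad`-invariant subspace `V` of `U = U(osp(1,2l))`, the products `V U` lie in `U V + U θ(V)`,
where `θ` is the parity automorphism, and `θ` preserves the left ideal `J_λ` that defines the Verma
module `M(λ)`. Hence `V` annihilates `M(λ)` if and only if `V ⊆ J_λ`, that is, if and only if `V`
annihilates the highest weight vector (`subset_annihilator_iff`). It remains to see that for a fixed
`u ∈ U` the condition `u ∈ J_λ` is polynomial in `λ`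
(`exists_polynomials_mem_vermaIdeal`). This holds because the Verma modules have a basis that does
not depend on `λ`: write `u` as a combination of Poincaré–Birkhoff–Witt monomials, the negative root
vectors coming first, then those in the Cartan subalgebra, then the positive ones. Modulo `J_λ` such
a monomial is a multiple, polynomial in `λ`, of its part in the negative root vectors. As the
monomials in the negative root vectors are linearly independent modulo `J_λ`
(`independent_mod_vermaIdeal`), `u` lies in `J_λ` if and only if finitely many polynomials vanish at
`λ`.

Two ingredients are needed.

* The root space decomposition for an arbitrary Cartan subalgebra `h` of `sp(2l)`. The trace form of
  the defining representation is nondegenerate on `h`, so `h` is abelian (`cartan_isLieAbelian`). The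
  nilpotent Jordan part of an element of `h` lies in `h` and is orthogonal to `h`, so `h` consists of
  semisimple matrices (`cartan_isSemisimple`). An odd element of weight zero has a nilpotent square
  in `h`, so zero is not an odd weight (`rootSpace_one_zero`).

* The Poincaré–Birkhoff–Witt theorem. That ordered monomials span is a straightening argument
  (`wordSpan_le_ordered`); it is used a second time, without unit, for the shifted generators
  `x - λ(x)` of the Borel subalgebra. For the linear independence (`linearIndependent_ordered`) the
  coproduct `U → U ⊗ End ℂ^{1|2l}` is composed with a linear functional on `End ℂ^{1|2l}` that
  vanishes on scalars and singles out one generator. The resulting map lowers the degree, and on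
  leading terms it removes that generator from a monomial, so that induction on the degree applies.
-/

noncomputable section

namespace Osp

/-! ### The form on `ℂ^{1|2l}` and the trace form on the even part -/

variable {l : ℕ}

theorem part_apply_eq_zero {p : ZMod 2} {X : Mat l} (hX : X ∈ part l p) {i j : Idx l}
    (h : parity l i ≠ parity l j + p) : X i j = 0 :=
  by_contra fun h0 => h (hX.1 i j h0)

theorem form_transpose_mul_form : (form l).transpose * form l = 1 := by
  simp [form, Matrix.fromBlocks_transpose, Matrix.fromBlocks_multiply, Matrix.J_transpose,
    Matrix.J_squared]

theorem form_mul_form_transpose : form l * (form l).transpose = 1 :=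
  mul_eq_one_comm.mp form_transpose_mul_form

theorem form_conjTranspose : (form l).conjTranspose = (form l).transpose := by
  simp [form, Matrix.fromBlocks_transpose, Matrix.fromBlocks_conjTranspose, Matrix.J]

/-- The `p`-th power of the parity automorphism of `ℂ^{1|2l}`. -/
def signMat (l : ℕ) (p : ZMod 2) : Mat l := Matrix.diagonal fun i => sgn (parity l i) p

theorem mem_part_zero_iff (X : Mat l) : X ∈ part l 0 ↔
    Commute X (signMat l 1) ∧ (form l).transpose * X.transpose * form l = -X := by
  refine and_congr ⟨fun h => ?_, fun h i j hij => ?_⟩ ⟨fun h => ?_, fun h i j => ?_⟩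
  · ext i j
    simp only [signMat, Matrix.mul_diagonal, Matrix.diagonal_mul]
    by_cases hij : X i j = 0
    · simp [hij]
    · rw [h i j hij, add_zero, mul_comm]
  · have h1 := congrFun (congrFun h i) j
    simp only [signMat, Matrix.mul_diagonal, Matrix.diagonal_mul] at h1
    have h2 : sgn (parity l j) 1 = sgn (parity l i) 1 := by
      apply mul_left_cancel₀ hij; rw [h1, mul_comm]
    revert h2
    rcases i with i | i <;> rcases j with j | j <;> simp [parity, sgn] <;> norm_num
  · have h1 : X.transpose * form l = -(form l * X) := by
      ext i j
      have := h i j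
      simp only [sgn, zero_ne_one, false_and, if_false, one_mul] at this
      simp only [Matrix.neg_apply]
      linear_combination this
    rw [Matrix.mul_assoc, h1, mul_neg, ← Matrix.mul_assoc, form_transpose_mul_form, one_mul]
  · have h1 : X.transpose * form l = -(form l * X) := by
      rw [← mul_neg, ← h, ← Matrix.mul_assoc, ← Matrix.mul_assoc, form_mul_form_transpose, one_mul]
    simp [h1, sgn]

theorem conjTranspose_mem_part_zero {X : Mat l} (hX : X ∈ part l 0) :
    X.conjTranspose ∈ part l 0 := by
  rw [mem_part_zero_iff] at hX ⊢
  obtain ⟨h1, h2⟩ := hX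
  have hs : (signMat l 1).conjTranspose = signMat l 1 := by
    rw [signMat, Matrix.diagonal_conjTranspose]
    congr 1
    ext i
    simp only [Pi.star_apply, sgn]
    split_ifs <;> simp
  refine ⟨?_, ?_⟩
  · have := congrArg Matrix.conjTranspose h1.eq
    rw [Matrix.conjTranspose_mul, Matrix.conjTranspose_mul, hs] at this
    exact this.symm
  · have h3 := congrArg Matrix.conjTranspose h2
    have h4 : (form l).transpose.conjTranspose = form l := by
      rw [← form_conjTranspose, Matrix.conjTranspose_conjTranspose]
    have h5 : X.transpose.conjTranspose = X.conjTranspose.transpose := rfl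
    simp only [Matrix.conjTranspose_mul, form_conjTranspose, Matrix.conjTranspose_neg, h4, h5] at h3
    calc _ = (form l).transpose * (X.conjTranspose.transpose * form l) := by
          rw [Matrix.mul_assoc]
      _ = _ := h3

open scoped ComplexOrder in
/-- The trace form of the defining representation is nondegenerate on the even part, since the even
part is closed under conjugate transposition. -/
theorem eq_zero_of_trace_mul_even_eq_zero {X : Mat l} (hX : X ∈ part l 0)
    (h : ∀ Y ∈ part l 0, (X * Y).trace = 0) : X = 0 :=
  Matrix.trace_mul_conjTranspose_self_eq_zero_iff.mp (h _ (conjTranspose_mem_part_zero hX))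

/-- The anti-automorphism of the matrix algebra that sends a matrix to its adjoint with respect to
the form, as a homomorphism to the opposite algebra. -/
def adjointHom (l : ℕ) : Mat l →ₐ[ℂ] (Mat l)ᵐᵒᵖ where
  toFun X := .op ((form l).transpose * X.transpose * form l)
  map_one' := by simp [form_transpose_mul_form]
  map_mul' X Y := by
    rw [← MulOpposite.op_mul, Matrix.transpose_mul]
    congr 1
    simp only [Matrix.mul_assoc]
    rw [← Matrix.mul_assoc (form l) (form l).transpose, form_mul_form_transpose, one_mul]
  map_zero' := by simp
  map_add' X Y := by simp [mul_add, add_mul]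
  commutes' c := by
    simp [Algebra.algebraMap_eq_smul_one, form_transpose_mul_form]

/-! ### Cartan subalgebras of the even part -/

/-- The trace form of the defining representation. -/
theorem traceForm_even_apply (X Y : even l) :
    LieModule.traceForm ℂ (even l) (Idx l → ℂ) X Y = ((X : Mat l) * (Y : Mat l)).trace := by
  rw [LieModule.traceForm_apply_apply]
  have h : ∀ X : even l, LieModule.toEnd ℂ (even l) (Idx l → ℂ) X = Matrix.toLin' (X : Mat l) := by
    intro X
    ext i j
    rfl
  rw [h, h, ← Matrix.toLin'_mul, Matrix.trace_toLin'_eq]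

/-- The trace form stays nondegenerate on a Cartan subalgebra `h`, since `h` is orthogonal to the
other component of the Fitting decomposition of the even part. -/
theorem cartan_trace_nondegenerate (h : LieSubalgebra ℂ (even l)) [h.IsCartanSubalgebra]
    (X : h) (hX : ∀ Y : h, (((X : even l) : Mat l) * ((Y : even l) : Mat l)).trace = 0) :
    X = 0 := by
  have hc := (LieModule.isCompl_genWeightSpace_zero_posFittingComp ℂ h (even l)).codisjoint
  have h0 : LieModule.genWeightSpace (even l) (0 : h → ℂ) = h.toLieSubmodule :=
    LieAlgebra.rootSpace_zero_eq ℂ (even l) h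
  have hX0 : ((X : even l) : Mat l) = 0 := by
    refine eq_zero_of_trace_mul_even_eq_zero (X : even l).2 fun Y hY => ?_
    have hY' : (⟨Y, hY⟩ : even l) ∈
        LieModule.genWeightSpace (even l) (0 : h → ℂ) ⊔ LieModule.posFittingComp ℂ h (even l) := by
      rw [codisjoint_iff.mp hc]; trivial
    obtain ⟨A, hA, B, hB, hAB⟩ := (LieSubmodule.mem_sup _ _ _).mp hY'
    have e1 : (((X : even l) : Mat l) * (A : Mat l)).trace = 0 := by
      rw [h0] at hA
      exact hX ⟨A, hA⟩
    have e2 : (((X : even l) : Mat l) * (B : Mat l)).trace = 0 := by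
      rw [← traceForm_even_apply]
      refine LieModule.eq_zero_of_mem_genWeightSpace_mem_posFitting ℂ h (even l)
        (B := LieModule.traceForm ℂ (even l) (Idx l → ℂ)) (fun x m n => ?_) ?_ hB
      · exact LieModule.traceForm_apply_lie_apply' ℂ (even l) (Idx l → ℂ) (x : even l) m n
      · rw [h0]; exact X.2
    have e3 : Y = (A : Mat l) + (B : Mat l) := (congrArg Subtype.val hAB).symm
    rw [e3, mul_add, Matrix.trace_add, e1, e2, add_zero]
  exact Subtype.ext (Subtype.ext hX0)

theorem cartan_isLieAbelian (h : LieSubalgebra ℂ (even l)) [h.IsCartanSubalgebra] :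
    IsLieAbelian h := by
  apply LieModule.isLieAbelian_of_ker_traceForm_eq_bot ℂ h (Idx l → ℂ)
  rw [LinearMap.ker_eq_bot']
  intro X hX
  apply cartan_trace_nondegenerate h X
  intro Y
  rw [← traceForm_even_apply]
  exact LinearMap.congr_fun hX Y

theorem cartan_commute (h : LieSubalgebra ℂ (even l)) [h.IsCartanSubalgebra] (X Y : h) :
    Commute ((X : even l) : Mat l) ((Y : even l) : Mat l) := by
  have := cartan_isLieAbelian h
  have h1 : ⁅X, Y⁆ = 0 := trivial_lie_zero _ _ _ _
  have h2 : ((⁅X, Y⁆ : h) : even l) = 0 := by rw [h1]; rfl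
  have h3 : (((⁅X, Y⁆ : h) : even l) : Mat l) = 0 := by rw [h2]; rfl
  exact sub_eq_zero.mp h3

/-- A Cartan subalgebra of the even part is its own centralizer. -/
theorem mem_cartan_of_commute (h : LieSubalgebra ℂ (even l)) [h.IsCartanSubalgebra] (X : even l)
    (hX : ∀ Y : h, Commute (X : Mat l) ((Y : even l) : Mat l)) : X ∈ h := by
  rw [← LieSubalgebra.IsCartanSubalgebra.self_normalizing (H := h), LieSubalgebra.mem_normalizer_iff]
  intro Y hY
  have : ⁅X, Y⁆ = 0 := by
    apply Subtype.ext
    exact sub_eq_zero.mpr (hX ⟨Y, hY⟩).eq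
  rw [this]
  exact zero_mem h

/-- A matrix as an endomorphism of the space of column vectors. -/
abbrev asEnd (l : ℕ) : Mat l ≃ₐ[ℂ] Module.End ℂ (Idx l → ℂ) := Matrix.toLinAlgEquiv'

theorem aeval_minpoly_asEnd (X : Mat l) : Polynomial.aeval X (minpoly ℂ (asEnd l X)) = 0 := by
  apply (asEnd l).injective
  have := Polynomial.aeval_algHom_apply (asEnd l).toAlgHom X (minpoly ℂ (asEnd l X))
  rw [map_zero]
  exact this.symm.trans (minpoly.aeval ℂ (asEnd l X))

theorem isSemisimple_adjoint {X : Mat l} (hX : (asEnd l X).IsSemisimple) :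
    (asEnd l (MulOpposite.unop (adjointHom l X))).IsSemisimple := by
  refine Module.End.isSemisimple_of_squarefree_aeval_eq_zero hX.minpoly_squarefree ?_
  have h2 : Polynomial.aeval (MulOpposite.unop (adjointHom l X)) (minpoly ℂ (asEnd l X)) = 0 := by
    apply MulOpposite.op_injective
    rw [← Polynomial.aeval_op_apply, MulOpposite.op_unop, Polynomial.aeval_algHom_apply,
      aeval_minpoly_asEnd, map_zero, MulOpposite.op_zero]
  have := Polynomial.aeval_algHom_apply (asEnd l).toAlgHom
    (MulOpposite.unop (adjointHom l X)) (minpoly ℂ (asEnd l X))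
  rw [h2, map_zero] at this
  exact this

/-- The elements of a Cartan subalgebra are semisimple matrices: the nilpotent part of the Jordan
decomposition of such an element lies in the even part by uniqueness, hence in the Cartan
subalgebra, and it is orthogonal to the latter for the trace form. -/
theorem cartan_isSemisimple (h : LieSubalgebra ℂ (even l)) [h.IsCartanSubalgebra] (X : h) :
    (asEnd l ((X : even l) : Mat l)).IsSemisimple := by
  set x : Mat l := ((X : even l) : Mat l) with hx
  obtain ⟨n', hn, s', hs, hnn, hss, hns⟩ := (asEnd l x).exists_isNilpotent_isSemisimple
  obtain ⟨n, rfl⟩ := (asEnd l).surjective n'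
  obtain ⟨s, rfl⟩ := (asEnd l).surjective s'
  have hxns : x = n + s := by
    apply (asEnd l).injective
    rw [hns, map_add]
  -- What commutes with `x` commutes with `n`, as `n` is a polynomial in `x`.
  have hcomm : ∀ y : Mat l, Commute x y → Commute n y := by
    intro y hy
    have h1 := Algebra.commute_of_mem_adjoin_singleton_of_commute hn (hy.map (asEnd l)).symm
    apply (asEnd l).injective
    rw [map_mul, map_mul]
    exact h1.eq.symm
  have hxpart := (mem_part_zero_iff x).mp (X : even l).2
  have hnil : IsNilpotent n := by
    simpa using hnn.map (asEnd l).symm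
  have hnsc : Commute n s := by
    have h1 : Commute n x := hcomm x (Commute.refl x)
    rw [hxns] at h1
    simpa using h1.sub_right (Commute.refl n)
  have hnmem : n ∈ part l 0 := by
    rw [mem_part_zero_iff]
    refine ⟨hcomm _ hxpart.1, ?_⟩
    set τ := fun Y : Mat l => MulOpposite.unop (adjointHom l Y) with hτ
    have hnil' : IsNilpotent (-τ n) := by
      refine IsNilpotent.neg ?_
      obtain ⟨k, hk⟩ := hnil.map (adjointHom l)
      refine ⟨k, ?_⟩
      rw [hτ]
      simp only
      rw [← MulOpposite.unop_pow, hk]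
      rfl
    have hss' : (asEnd l (-τ s)).IsSemisimple := by
      rw [map_neg, Module.End.isSemisimple_neg]
      exact isSemisimple_adjoint hss
    have hcomm' : Commute (-τ n) (-τ s) := by
      change _ * _ = _ * _
      rw [neg_mul_neg, neg_mul_neg]
      simp only [hτ]
      rw [← MulOpposite.unop_mul, ← MulOpposite.unop_mul, ← map_mul, ← map_mul, hnsc.eq]
    have hsum : -τ n + -τ s = n + s := by
      rw [← neg_add, hτ]
      simp only
      rw [← MulOpposite.unop_add, ← map_add, ← hxns]
      exact neg_eq_iff_eq_neg.mpr hxpart.2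
    have hu := Module.End.isNilpotent_isSemisimple_unique
      (hnil'.map (asEnd l)) hss' hnn hss (hcomm'.map (asEnd l)) (hnsc.map (asEnd l))
      (by rw [← map_add, ← map_add, hsum])
    exact neg_eq_iff_eq_neg.mp ((asEnd l).injective hu.1)
  have hnh : (⟨n, hnmem⟩ : even l) ∈ h :=
    mem_cartan_of_commute h _ fun Y => hcomm _ (cartan_commute h X Y)
  have hn0 : (⟨⟨n, hnmem⟩, hnh⟩ : h) = 0 := by
    apply cartan_trace_nondegenerate h
    intro Y
    have h1 : IsNilpotent (n * ((Y : even l) : Mat l)) :=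
      (hcomm _ (cartan_commute h X Y)).isNilpotent_mul_right hnil
    exact (Matrix.isNilpotent_trace_of_isNilpotent h1).eq_zero
  have hn00 : n = 0 := congrArg (fun Z : h => ((Z : even l) : Mat l)) hn0
  rw [hns, hn00, map_zero, zero_add]
  exact hss

end Osp

namespace Osp

/-! ### The root space decomposition of `osp(1,2l)` -/

variable {l : ℕ}

/-- The commutator with an element `H` of `h`, on the part of parity `p`. -/
def adPart (h : LieSubalgebra ℂ (even l)) (p : ZMod 2) (H : h) : Module.End ℂ (part l p) :=
  (LinearMap.mulLeft ℂ ((H : even l) : Mat l) - LinearMap.mulRight ℂ ((H : even l) : Mat l)).restrict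
    (p := part l p) (q := part l p) fun x hx => by
      have h1 := bracket_mem (H : even l).2 hx
      rw [zero_add] at h1
      simpa [sgn] using h1

theorem coe_adPart (h : LieSubalgebra ℂ (even l)) (p : ZMod 2) (H : h) (x : part l p) :
    (adPart h p H x : Mat l) =
      ((H : even l) : Mat l) * (x : Mat l) - (x : Mat l) * ((H : even l) : Mat l) := rfl

theorem mem_rootSpace_iff {h : LieSubalgebra ℂ (even l)} {p : ZMod 2} {α : Module.Dual ℂ h}
    {x : part l p} : x ∈ rootSpace h p α ↔ ∀ H : h, adPart h p H x = α H • x :=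
  forall_congr' fun _ => ⟨fun h1 => Subtype.ext h1, fun h1 => congrArg Subtype.val h1⟩

variable (h : LieSubalgebra ℂ (even l)) [h.IsCartanSubalgebra] (p : ZMod 2)

theorem adPart_commute (H K : h) : Commute (adPart h p H) (adPart h p K) := by
  apply LinearMap.ext
  intro x
  apply Subtype.ext
  simp only [Module.End.mul_apply, coe_adPart]
  have := (cartan_commute h H K).eq
  have e1 : ((H : even l) : Mat l) * (((K : even l) : Mat l) * (x : Mat l)) =
      ((K : even l) : Mat l) * (((H : even l) : Mat l) * (x : Mat l)) := by
    rw [← mul_assoc, this, mul_assoc]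
  simp only [mul_sub, sub_mul, mul_assoc, e1, this]
  abel

theorem adPart_isSemisimple (H : h) : (adPart h p H).IsSemisimple := by
  have ha := cartan_isSemisimple h H
  set a : Mat l := ((H : even l) : Mat l)
  have h0 := aeval_minpoly_asEnd a
  have hl : Module.End.IsSemisimple (LinearMap.mulLeft ℂ a) := by
    apply Module.End.isSemisimple_of_squarefree_aeval_eq_zero ha.minpoly_squarefree
    have : Polynomial.aeval (Algebra.lmul ℂ (Mat l) a) (minpoly ℂ (asEnd l a)) = 0 := by
      rw [Polynomial.aeval_algHom_apply, h0, map_zero]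
    simpa using! this
  have hr : Module.End.IsSemisimple (LinearMap.mulRight ℂ a) := by
    apply Module.End.isSemisimple_of_squarefree_aeval_eq_zero ha.minpoly_squarefree
    have hrw : LinearMap.mulRight ℂ a =
        (Algebra.lsmul (A := (Mat l)ᵐᵒᵖ) ℂ ℂ (Mat l)) (.op a) := by
      ext; simp [Algebra.lsmul]
    rw [hrw, Polynomial.aeval_algHom_apply, Polynomial.aeval_op_apply, h0, MulOpposite.op_zero,
      map_zero]
  exact (hl.sub_of_commute (LinearMap.commute_mulLeft_right a a) hr).restrict _

theorem rootSpace_eq_iInf (α : Module.Dual ℂ h) :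
    rootSpace h p α = ⨅ H : h, (adPart h p H).maxGenEigenspace (α H) := by
  ext x
  rw [mem_rootSpace_iff, Submodule.mem_iInf]
  refine forall_congr' fun H => ?_
  rw [(adPart_isSemisimple h p H).isFinitelySemisimple.maxGenEigenspace_eq_eigenspace,
    Module.End.mem_eigenspace_iff]

theorem iSupIndep_rootSpace : iSupIndep (rootSpace h p) := by
  have h1 := Module.End.independent_iInf_maxGenEigenspace_of_forall_mapsTo (adPart h p)
    fun i j φ => Module.End.mapsTo_maxGenEigenspace_of_comm (adPart_commute h p j i) φ
  have h2 := h1.comp (f := fun α : Module.Dual ℂ h => (α : h → ℂ)) DFunLike.coe_injective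
  convert! h2 using 1
  ext1 α
  exact rootSpace_eq_iInf h p α

theorem iSup_rootSpace : ⨆ α, rootSpace h p α = ⊤ := by
  have h1 := Module.End.iSup_iInf_maxGenEigenspace_eq_top_of_forall_mapsTo (adPart h p)
    (fun i j φ => Module.End.mapsTo_maxGenEigenspace_of_comm (adPart_commute h p j i) φ)
    fun i => Module.End.iSup_maxGenEigenspace_eq_top _
  rw [eq_top_iff, ← h1]
  refine iSup_le fun χ => ?_
  by_cases hχ : (⨅ H : h, (adPart h p H).maxGenEigenspace (χ H)) = ⊥
  · rw [hχ]; exact bot_le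
  obtain ⟨x, hx, hx0⟩ := Submodule.exists_mem_ne_zero_of_ne_bot hχ
  have hx' : ∀ H, adPart h p H x = χ H • x := by
    intro H
    have h2 := (Submodule.mem_iInf _).mp hx H
    rwa [(adPart_isSemisimple h p H).isFinitelySemisimple.maxGenEigenspace_eq_eigenspace,
      Module.End.mem_eigenspace_iff] at h2
  -- A nonzero joint eigenvector makes the eigenvalues linear in `H`.
  let α : Module.Dual ℂ h :=
    { toFun := χ
      map_add' := fun H K => by
        apply smul_left_injective ℂ hx0
        simp only [add_smul]
        rw [← hx', ← hx', ← hx']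
        apply Subtype.ext
        have e : (((H + K : h) : even l) : Mat l) = ((H : even l) : Mat l) + ((K : even l) : Mat l) :=
          rfl
        simp only [Submodule.coe_add, coe_adPart, e, add_mul, mul_add]
        abel
      map_smul' := fun c H => by
        apply smul_left_injective ℂ hx0
        simp only [RingHom.id_apply, smul_eq_mul, mul_smul]
        rw [← hx', ← hx']
        apply Subtype.ext
        have e : (((c • H : h) : even l) : Mat l) = c • ((H : even l) : Mat l) := rfl
        simp only [Submodule.coe_smul, coe_adPart, e, Matrix.smul_mul,
          Matrix.mul_smul, smul_sub] }
  have : (⨅ H : h, (adPart h p H).maxGenEigenspace (χ H)) = rootSpace h p α :=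
    (rootSpace_eq_iInf h p α).symm
  rw [this]
  exact le_iSup (rootSpace h p) α

open Classical in
theorem isInternal_rootSpace : DirectSum.IsInternal (rootSpace h p) :=
  DirectSum.isInternal_submodule_of_iSupIndep_of_iSup_eq_top (iSupIndep_rootSpace h p)
    (iSup_rootSpace h p)

theorem mem_cartan_of_mem_rootSpace_zero {x : part l 0} (hx : x ∈ rootSpace h 0 0) :
    (⟨x, x.2⟩ : even l) ∈ h := by
  apply mem_cartan_of_commute
  intro Y
  have h1 := hx Y
  simp only [LinearMap.zero_apply, zero_smul] at h1
  exact (sub_eq_zero.mp h1).symm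

/-- An odd element is determined by its upper right block. -/
theorem odd_eq_zero {y : Mat l} (hy : y ∈ part l 1) (h0 : ∀ j, y (.inl ()) (.inr j) = 0) :
    y = 0 := by
  have h1 : ∀ j, y (.inr j) (.inl ()) = 0 := by
    intro j
    -- The relation determines `Jᵀ` times the lower left block.
    have h2 : ∀ k, ((Matrix.J (Fin l) ℂ).transpose.mulVec fun i => y (.inr i) (.inl ())) k = 0 := by
      intro k
      have h3 := hy.2 (.inl ()) (.inr k)
      simp only [Matrix.mul_apply, Fintype.sum_sum_type, form, Matrix.fromBlocks_apply₁₁,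
        Matrix.fromBlocks_apply₁₂, Matrix.fromBlocks_apply₂₂, Matrix.zero_apply,
        Matrix.transpose_apply, mul_zero, zero_mul, Finset.sum_const_zero, add_zero, zero_add,
        h0] at h3
      simpa [Matrix.mulVec, dotProduct, mul_comm] using h3
    have h4 : ((Matrix.J (Fin l) ℂ) * (Matrix.J (Fin l) ℂ).transpose).mulVec
        (fun i => y (.inr i) (.inl ())) = 0 := by
      rw [← Matrix.mulVec_mulVec, funext h2]
      exact Matrix.mulVec_zero _
    rw [Matrix.J_transpose, mul_neg, Matrix.J_squared, neg_neg, Matrix.one_mulVec] at h4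
    exact congrFun h4 j
  ext i j
  rcases i with ⟨⟩ | i <;> rcases j with ⟨⟩ | j
  · exact part_apply_eq_zero hy (by simp [parity])
  · exact h0 j
  · exact h1 i
  · exact part_apply_eq_zero hy (by simp [parity])

/-- Zero is not an odd weight: the square of an odd element of weight zero is a nilpotent element
of the Cartan subalgebra, hence zero. -/
theorem rootSpace_one_zero : rootSpace h 1 0 = ⊥ := by
  rw [Submodule.eq_bot_iff]
  intro x hx
  set y : Mat l := (x : Mat l) with hy
  have hc : ∀ H : h, Commute y ((H : even l) : Mat l) := by
    intro H
    have h1 := hx H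
    simp only [LinearMap.zero_apply, zero_smul] at h1
    exact (sub_eq_zero.mp h1).symm
  have hsq : y * y ∈ part l 0 := by
    have h1 := bracket_mem x.2 x.2
    have h2 : y * y - sgn 1 1 • (y * y) = (2 : ℂ) • (y * y) := by
      simp [sgn, two_smul]
    rw [← hy, h2] at h1
    have h3 := (part l (1 + 1)).smul_mem (2⁻¹ : ℂ) h1
    rw [smul_smul] at h3
    norm_num at h3
    exact h3
  have hmem : (⟨y * y, hsq⟩ : even l) ∈ h :=
    mem_cartan_of_commute h _ fun Y => (hc Y).mul_left (hc Y)
  have h11 : ∀ i j, y (.inl i) (.inl j) = 0 := fun i j =>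
    part_apply_eq_zero x.2 (by simp [parity])
  have h22 : ∀ i j, y (.inr i) (.inr j) = 0 := fun i j =>
    part_apply_eq_zero x.2 (by simp [parity])
  -- The upper left entry of `y ^ 2` lies in an even element, so it vanishes; hence `y ^ 4 = 0`.
  have h0 : ∑ j, y (.inl ()) (.inr j) * y (.inr j) (.inl ()) = 0 := by
    have h1 := hsq.2 (.inl ()) (.inl ())
    simp only [Matrix.mul_apply, Fintype.sum_sum_type, form, Matrix.fromBlocks_apply₁₁,
        Matrix.fromBlocks_apply₁₂, Matrix.fromBlocks_apply₂₁, Matrix.zero_apply, h11,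
        Matrix.transpose_apply, mul_zero, zero_mul, Finset.sum_const_zero, add_zero, zero_add] at h1
    rw [Fintype.sum_sum_type]
    simp [sgn] at h1
    exact h1
  have hB : y = Matrix.fromBlocks 0 (y.toBlocks₁₂) (y.toBlocks₂₁) 0 := by
    ext i j
    rcases i with i | i <;> rcases j with j | j
    · exact h11 i j
    · rfl
    · rfl
    · exact h22 i j
  have h12 : y.toBlocks₁₂ * y.toBlocks₂₁ = 0 := by
    ext i j
    exact h0
  have hsq' : y * y = Matrix.fromBlocks 0 0 0 (y.toBlocks₂₁ * y.toBlocks₁₂) := by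
    conv_lhs => rw [hB]
    rw [Matrix.fromBlocks_multiply, h12]
    simp
  have hnil : (y * y) * (y * y) = 0 := by
    rw [hsq', Matrix.fromBlocks_multiply]
    have : y.toBlocks₂₁ * y.toBlocks₁₂ * (y.toBlocks₂₁ * y.toBlocks₁₂) = 0 := by
      rw [Matrix.mul_assoc, ← Matrix.mul_assoc y.toBlocks₁₂, h12]
      simp
    simp [this]
  have hzero : y * y = 0 := by
    apply (asEnd l).injective
    rw [map_zero]
    refine Module.End.eq_zero_of_isNilpotent_isSemisimple ⟨2, ?_⟩
      (cartan_isSemisimple h ⟨⟨y * y, hsq⟩, hmem⟩)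
    rw [← map_pow, pow_two]
    exact (congrArg _ hnil).trans (map_zero _)
  have h21 : ∀ i j, y (.inr i) (.inl ()) * y (.inl ()) (.inr j) = 0 := by
    intro i j
    have := congrFun (congrFun hzero (.inr i)) (.inr j)
    simpa [Matrix.mul_apply, h22] using this
  apply Subtype.ext
  apply odd_eq_zero x.2
  intro j
  by_contra hj
  have h3 : ∀ i, y (.inr i) (.inl ()) = 0 := fun i =>
    (mul_eq_zero.mp (h21 i j)).resolve_right hj
  -- A vanishing lower left block makes the upper right block vanish.
  have h4 := x.2.2 (.inl ()) (.inr j)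
  simp only [Matrix.mul_apply, Fintype.sum_sum_type, form, Matrix.fromBlocks_apply₁₁,
    Matrix.fromBlocks_apply₁₂, Matrix.fromBlocks_apply₂₂, Matrix.zero_apply, ← hy, h3, h11,
    Matrix.transpose_apply, mul_zero, zero_mul, Finset.sum_const_zero, add_zero, zero_add] at h4
  simp [sgn, parity] at h4
  exact hj h4

end Osp

namespace Osp

/-! ### Ordered words in supercommuting generators -/

section Words

variable {U : Type*} [Ring U] {ι : Type*}

/-- The product of the generators `z i` along a list of indices. -/
def word (z : ι → U) (w : List ι) : U := (w.map z).prod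

@[simp] theorem word_nil (z : ι → U) : word z [] = 1 := rfl

@[simp] theorem word_cons (z : ι → U) (i : ι) (w : List ι) : word z (i :: w) = z i * word z w := by
  simp [word]

theorem word_append (z : ι → U) (v w : List ι) : word z (v ++ w) = word z v * word z w := by
  simp [word]

variable [Algebra ℂ U]

/-- The span of the words of length at least `m` and less than `k`. -/
def wordSpan (z : ι → U) (m k : ℕ) : Submodule ℂ U :=
  Submodule.span ℂ (word z '' {w | m ≤ w.length ∧ w.length < k})

theorem word_mem_wordSpan (z : ι → U) {m k : ℕ} {w : List ι} (h1 : m ≤ w.length)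
    (h2 : w.length < k) : word z w ∈ wordSpan z m k :=
  Submodule.subset_span ⟨w, ⟨h1, h2⟩, rfl⟩

theorem wordSpan_mono (z : ι → U) (m : ℕ) {k k' : ℕ} (h : k ≤ k') :
    wordSpan z m k ≤ wordSpan z m k' :=
  Submodule.span_mono (Set.image_mono fun _ hw => ⟨hw.1, hw.2.trans_le h⟩)

theorem wordSpan_zero (z : ι → U) (m : ℕ) : wordSpan z m 0 = ⊥ := by
  simp [wordSpan]

theorem word_mul_mem (z : ι → U) {m k : ℕ} (v : List ι) {u : U} (hu : u ∈ wordSpan z m k) :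
    word z v * u ∈ wordSpan z m (v.length + k) := by
  induction hu using Submodule.span_induction with
  | mem x hx =>
    obtain ⟨w, hw, rfl⟩ := hx
    rw [← word_append]
    apply word_mem_wordSpan <;> simp only [List.length_append]
    · exact hw.1.trans (by omega)
    · have := hw.2; omega
  | zero => simp
  | add x y _ _ hx hy => rw [mul_add]; exact add_mem hx hy
  | smul c x _ hx => rw [mul_smul_comm]; exact Submodule.smul_mem _ _ hx

theorem mul_word_mem (z : ι → U) {m k : ℕ} (v : List ι) {u : U} (hu : u ∈ wordSpan z m k) :
    u * word z v ∈ wordSpan z m (k + v.length) := by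
  induction hu using Submodule.span_induction with
  | mem x hx =>
    obtain ⟨w, hw, rfl⟩ := hx
    rw [← word_append]
    apply word_mem_wordSpan <;> simp only [List.length_append]
    · exact hw.1.trans (by omega)
    · have := hw.2; omega
  | zero => simp
  | add x y _ _ hx hy => rw [add_mul]; exact add_mem hx hy
  | smul c x _ hx => rw [smul_mul_assoc]; exact Submodule.smul_mem _ _ hx

theorem gen_mul_mem (z : ι → U) {m k : ℕ} (i : ι) {u : U} (hu : u ∈ wordSpan z m k) :
    z i * u ∈ wordSpan z m (k + 1) := by
  have := word_mul_mem z [i] hu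
  rw [add_comm]
  simpa using this

variable (par : ι → ZMod 2)

/-- Permuting the letters of a word changes it by a scalar and by shorter words. -/
theorem word_perm (z : ι → U) {m : ℕ}
    (hrel : ∀ i j, z i * z j - sgn (par i) (par j) • (z j * z i) ∈ wordSpan z m 2)
    {v w : List ι} (hvw : v.Perm w) :
    ∃ c : ℂ, word z v - c • word z w ∈ wordSpan z m v.length := by
  induction hvw with
  | nil => exact ⟨1, by simp⟩
  | cons i _ ih =>
    obtain ⟨c, hc⟩ := ih
    refine ⟨c, ?_⟩
    have := gen_mul_mem z i hc
    rwa [mul_sub, mul_smul_comm] at this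
  | swap i j t =>
    refine ⟨sgn (par j) (par i), ?_⟩
    have := mul_word_mem z t (hrel j i)
    rw [sub_mul, smul_mul_assoc, mul_assoc, mul_assoc] at this
    rw [show 2 + t.length = (j :: i :: t).length by simp; omega] at this
    simpa only [word_cons] using this
  | trans h1 _ ih1 ih2 =>
    obtain ⟨c, hc⟩ := ih1
    obtain ⟨d, hd⟩ := ih2
    refine ⟨c * d, ?_⟩
    rw [← h1.length_eq] at hd
    have := add_mem hc (Submodule.smul_mem _ c hd)
    rwa [smul_sub, smul_smul, sub_add_sub_cancel] at this

variable [LinearOrder ι]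

/-- The index lists of the Poincaré–Birkhoff–Witt monomials: weakly increasing, without repetition
of odd indices. -/
def IsOrdered (w : List ι) : Prop := w.Pairwise fun i j => i < j ∨ i = j ∧ par i = 0

theorem IsOrdered.sorted {par : ι → ZMod 2} {w : List ι} (h : IsOrdered par w) :
    w.Pairwise (· ≤ ·) :=
  h.imp fun hij => hij.elim le_of_lt fun h' => h'.1.le

theorem exists_odd_repeat {w : List ι} (hs : w.Pairwise (· ≤ ·)) (hw : ¬ IsOrdered par w) :
    ∃ a i b, w = a ++ i :: i :: b ∧ par i = 1 := by
  have : IsTrans ι fun i j => i < j ∨ i = j ∧ par i = 0 := ⟨by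
    rintro i j k (h1 | ⟨rfl, h1⟩) (h2 | ⟨rfl, h2⟩)
    · exact .inl (h1.trans h2)
    · exact .inl h1
    · exact .inl h2
    · exact .inr ⟨rfl, h1⟩⟩
  rw [IsOrdered, ← List.isChain_iff_pairwise, List.isChain_iff_forall_rel_of_append_cons_cons] at hw
  push Not at hw
  obtain ⟨i, j, a, b, rfl, h1, h2⟩ := hw
  have hij : i ≤ j := (List.pairwise_cons.mp (List.pairwise_append.mp hs).2.1).1 j (by simp)
  have hij' : i = j := le_antisymm hij h1
  subst hij'
  refine ⟨a, i, b, rfl, ?_⟩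
  have h3 := h2 rfl
  revert h3
  generalize par i = q
  revert q
  decide

/-- Words are combinations of ordered words. With `m = 1` this concerns the generators without
unit. -/
theorem wordSpan_le_ordered (z : ι → U) {m : ℕ}
    (hrel : ∀ i j, z i * z j - sgn (par i) (par j) • (z j * z i) ∈ wordSpan z m 2) (k : ℕ) :
    wordSpan z m k ≤ Submodule.span ℂ (word z '' {w | IsOrdered par w ∧ m ≤ w.length}) := by
  induction k with
  | zero => rw [wordSpan_zero]; exact bot_le
  | succ k ih =>
    refine Submodule.span_le.mpr ?_
    rintro _ ⟨w, ⟨hm, hk⟩, rfl⟩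
    have hk' : w.length ≤ k := Nat.lt_succ_iff.mp hk
    have hp : w.Perm (w.insertionSort (· ≤ ·)) := (List.perm_insertionSort (· ≤ ·) w).symm
    obtain ⟨c, hc⟩ := word_perm par z hrel hp
    have h1 := ih (wordSpan_mono z m hk' hc)
    rw [← sub_add_cancel (word z w) (c • word z (w.insertionSort (· ≤ ·)))]
    refine add_mem h1 (Submodule.smul_mem _ c ?_)
    by_cases ho : IsOrdered par (w.insertionSort (· ≤ ·))
    · exact Submodule.subset_span ⟨_, ⟨ho, by rwa [← hp.length_eq]⟩, rfl⟩
    · obtain ⟨a, i, b, hw, hi⟩ := exists_odd_repeat par (List.pairwise_insertionSort (· ≤ ·) w) ho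
      apply ih
      apply wordSpan_mono z m hk'
      rw [hp.length_eq, hw]
      -- The square of an odd generator is half its supercommutator with itself.
      have h2 : z i * z i ∈ wordSpan z m 2 := by
        have h3 := Submodule.smul_mem _ (2⁻¹ : ℂ) (hrel i i)
        have h4 : z i * z i - sgn (par i) (par i) • (z i * z i) = (2 : ℂ) • (z i * z i) := by
          simp [hi, sgn, two_smul]
        rwa [h4, smul_smul, inv_mul_cancel₀ two_ne_zero, one_smul] at h3
      have h5 := word_mul_mem z a (mul_word_mem z b h2)
      simp only [word_append, word_cons, List.length_append, List.length_cons]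
      rw [mul_assoc] at h5
      convert! h5 using 2
      omega

end Words

end Osp

namespace Osp

/-! ### The coproduct with one leg in the matrix algebra -/

open scoped TensorProduct

variable {l : ℕ}

theorem signMat_mul (p q : ZMod 2) : signMat l p * signMat l q = signMat l (p + q) := by
  simp [signMat, Matrix.diagonal_mul_diagonal, sgn_add_right]

theorem signMat_zero : signMat l 0 = 1 := by
  simp [signMat, sgn]

theorem signMat_mul_part {p q : ZMod 2} {X : Mat l} (hX : X ∈ part l q) :
    signMat l p * X = sgn p q • (X * signMat l p) := by
  ext i j
  simp only [signMat, Matrix.diagonal_mul, Matrix.mul_diagonal, Matrix.smul_apply, smul_eq_mul]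
  by_cases h : X i j = 0
  · simp [h]
  · rw [hX.1 i j h, sgn_add_left, sgn_comm q p]
    ring

/-- The coproduct `x ↦ x ⊗ 1 + 1 ⊗ x` of the enveloping algebra, followed by the defining
representation on the second leg. The ordinary tensor product of algebras is used; the signs of the
super tensor product are produced by the matrices `signMat`. -/
def coprod (l : ℕ) : Env l →ₐ[ℂ] Env l ⊗[ℂ] Mat l :=
  RingQuot.liftAlgHom ℂ ⟨TensorAlgebra.lift ℂ (DirectSum.toModule ℂ (ZMod 2) _ fun p =>
    (TensorProduct.mk ℂ (Env l) (Mat l)).flip (signMat l p) ∘ₗ gen l p +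
      TensorProduct.mk ℂ (Env l) (Mat l) 1 ∘ₗ (part l p).subtype), by
    rintro _ _ ⟨p, q, x, y⟩
    simp only [map_mul, map_add, map_smul, TensorAlgebra.lift_ι_apply, DirectSum.toModule_lof,
      LinearMap.add_apply, LinearMap.comp_apply, LinearMap.flip_apply, TensorProduct.mk_apply,
      Submodule.subtype_apply, mul_add, add_mul, Algebra.TensorProduct.tmul_mul_tmul, one_mul,
      mul_one, signMat_mul, smul_add]
    have e : ((bracket x y : part l (p + q)) : Mat l) =
      (x : Mat l) * y - sgn p q • ((y : Mat l) * x) := rfl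
    rw [gen_mul_gen x y, signMat_mul_part x.2, signMat_mul_part y.2, e, add_comm q p,
      sgn_comm q p, TensorProduct.add_tmul, TensorProduct.tmul_sub]
    simp only [TensorProduct.tmul_smul, TensorProduct.smul_tmul', smul_smul, sgn_mul_self, one_smul]
    abel⟩

theorem coprod_gen {p : ZMod 2} (x : part l p) :
    coprod l (gen l p x) = gen l p x ⊗ₜ signMat l p + 1 ⊗ₜ (x : Mat l) := by
  simp [coprod, gen]

/-- The linear endomorphism of the enveloping algebra obtained from the coproduct by applying a
linear functional on matrices to the second leg. -/
def contract (φ : Module.Dual ℂ (Mat l)) : Env l →ₗ[ℂ] Env l :=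
  (TensorProduct.rid ℂ (Env l)).toLinearMap ∘ₗ φ.lTensor (Env l) ∘ₗ (coprod l).toLinearMap

theorem contract_one (φ : Module.Dual ℂ (Mat l)) : contract φ 1 = φ 1 • 1 := by
  simp [contract, Algebra.TensorProduct.one_def]

theorem rid_lTensor_tmul_mul (φ : Module.Dual ℂ (Mat l)) (a : Env l) (m : Mat l)
    (t : Env l ⊗[ℂ] Mat l) :
    TensorProduct.rid ℂ (Env l) (φ.lTensor (Env l) ((a ⊗ₜ m) * t)) =
      a * TensorProduct.rid ℂ (Env l) ((φ ∘ₗ LinearMap.mulLeft ℂ m).lTensor (Env l) t) := by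
  induction t with
  | zero => simp
  | tmul b n => simp
  | add x y hx hy => simp only [mul_add, map_add, hx, hy]

theorem contract_mul {φ : Module.Dual ℂ (Mat l)} {z : Env l} {s x : Mat l}
    (hz : coprod l z = z ⊗ₜ s + 1 ⊗ₜ x) (u : Env l) :
    contract φ (z * u) = z * contract (φ ∘ₗ LinearMap.mulLeft ℂ s) u +
      contract (φ ∘ₗ LinearMap.mulLeft ℂ x) u := by
  simp only [contract, LinearMap.comp_apply, AlgHom.toLinearMap_apply, map_mul, hz, add_mul,
    map_add, LinearEquiv.coe_coe, rid_lTensor_tmul_mul, one_mul]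

/-- The augmentation of the enveloping algebra. -/
def augmentation (l : ℕ) : Env l →ₐ[ℂ] ℂ :=
  RingQuot.liftAlgHom ℂ ⟨TensorAlgebra.lift ℂ 0, by rintro _ _ ⟨p, q, x, y⟩; simp⟩

instance : Nontrivial (Env l) := (augmentation l).toRingHom.domain_nontrivial

/-! ### Linear independence of the ordered words -/

section Independence

variable {ι : Type*} (par : ι → ZMod 2) (x : ι → Mat l) (z : ι → Env l)

/-- The total parity of a word. -/
def wordParity (w : List ι) : ZMod 2 := (w.map par).sum

/-- A functional on matrices that separates the generator `x j` from the other generators and from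
the scalars, also after multiplication with the matrices `signMat`. -/
structure IsAdapted (j : ι) (φ : Module.Dual ℂ (Mat l)) : Prop where
  sign : ∀ p, φ (signMat l p) = 0
  ne : ∀ i, i ≠ j → ∀ p, φ (x i * signMat l p) = 0
  self : ∀ p, φ (x j * signMat l p) ≠ 0

variable {par x z}

theorem IsAdapted.comp_signMat (hx : ∀ i, x i ∈ part l (par i)) {j : ι}
    {φ : Module.Dual ℂ (Mat l)} (h : IsAdapted x j φ) (q : ZMod 2) :
    IsAdapted x j (φ ∘ₗ LinearMap.mulLeft ℂ (signMat l q)) := by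
  have key : ∀ i p, (φ ∘ₗ LinearMap.mulLeft ℂ (signMat l q)) (x i * signMat l p) =
      sgn q (par i) * φ (x i * signMat l (q + p)) := by
    intro i p
    rw [LinearMap.comp_apply, LinearMap.mulLeft_apply, ← mul_assoc, signMat_mul_part (hx i),
      smul_mul_assoc, mul_assoc, signMat_mul, map_smul, smul_eq_mul]
  refine ⟨fun p => ?_, fun i hi p => ?_, fun p => ?_⟩
  · simp [signMat_mul, h.sign]
  · rw [key, h.ne i hi, mul_zero]
  · rw [key]
    refine mul_ne_zero (fun h0 => ?_) (h.self _)
    have := sgn_mul_self q (par j)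
    rw [h0] at this
    simp at this

section

variable (hz : ∀ i, coprod l (z i) = z i ⊗ₜ signMat l (par i) + 1 ⊗ₜ x i)

include hz

/-- The leading term of the contraction of a word. -/
theorem contract_word (φ : Module.Dual ℂ (Mat l)) (w : List ι) :
    contract φ (word z w) - φ (signMat l (wordParity par w)) • word z w ∈
      wordSpan z 0 w.length := by
  induction w generalizing φ with
  | nil => simp [contract_one, wordParity, signMat_zero]
  | cons i t ih =>
    have h1 := gen_mul_mem z i (ih (φ ∘ₗ LinearMap.mulLeft ℂ (signMat l (par i))))
    have h2 := ih (φ ∘ₗ LinearMap.mulLeft ℂ (x i))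
    have h3 : contract (φ ∘ₗ LinearMap.mulLeft ℂ (x i)) (word z t) ∈
        wordSpan z 0 (t.length + 1) := by
      rw [← sub_add_cancel (contract _ _) (φ (x i * signMat l (wordParity par t)) • word z t)]
      exact add_mem (wordSpan_mono z 0 (Nat.le_succ _) h2)
        (Submodule.smul_mem _ (φ (x i * signMat l (wordParity par t)))
          (word_mem_wordSpan z (Nat.zero_le _) (Nat.lt_succ_self _)))
    have h4 := add_mem h1 h3
    rw [word_cons, contract_mul (hz i)]
    convert! h4 using 1
    simp only [LinearMap.comp_apply, LinearMap.mulLeft_apply, signMat_mul, mul_sub, mul_smul_comm,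
      wordParity, List.map_cons, List.sum_cons]
    abel

theorem contract_mem {φ : Module.Dual ℂ (Mat l)} (hφ : ∀ p, φ (signMat l p) = 0) {k : ℕ}
    {u : Env l} (hu : u ∈ wordSpan z 0 (k + 1)) : contract φ u ∈ wordSpan z 0 k := by
  induction hu using Submodule.span_induction with
  | mem x hx =>
    obtain ⟨w, hw, rfl⟩ := hx
    have := contract_word hz φ w
    rw [hφ, zero_smul, sub_zero] at this
    exact wordSpan_mono z 0 (Nat.lt_succ_iff.mp hw.2) this
  | zero => simp
  | add x y _ _ hx hy => rw [map_add]; exact add_mem hx hy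
  | smul c x _ hx => rw [map_smul]; exact Submodule.smul_mem _ _ hx

end

theorem gen_mul_mem_pred (z : ι → Env l) (i : ι) {n : ℕ} {u : Env l}
    (hu : u ∈ wordSpan z 0 (n - 1)) : z i * u ∈ wordSpan z 0 n := by
  cases n with
  | zero =>
    rw [Nat.zero_sub, wordSpan_zero, Submodule.mem_bot] at hu
    simp [hu]
  | succ n => exact gen_mul_mem z i hu

section

variable (hx : ∀ i, x i ∈ part l (par i))
  (hz : ∀ i, coprod l (z i) = z i ⊗ₜ signMat l (par i) + 1 ⊗ₜ x i)

include hx hz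

theorem contract_word_of_notMem {j : ι} {φ : Module.Dual ℂ (Mat l)} (hφ : IsAdapted x j φ)
    {w : List ι} (hj : j ∉ w) : contract φ (word z w) ∈ wordSpan z 0 (w.length - 1) := by
  induction w generalizing φ with
  | nil =>
    have := hφ.sign 0
    rw [signMat_zero] at this
    simp [contract_one, this]
  | cons i t ih =>
    rw [List.mem_cons, not_or] at hj
    rw [word_cons, contract_mul (hz i), List.length_cons, Nat.add_sub_cancel]
    refine add_mem (gen_mul_mem_pred z i (ih (hφ.comp_signMat hx _) hj.2)) ?_
    have := contract_word hz (φ ∘ₗ LinearMap.mulLeft ℂ (x i)) t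
    simpa [hφ.ne i (Ne.symm hj.1)] using this

variable [LinearOrder ι]

/-- Up to shorter words, contracting an ordered word with a functional adapted to the letter `j`
removes one letter `j`, with a nonzero coefficient: an even letter `j` contributes the same scalar
once for each of its occurrences, and an odd one occurs only once. -/
theorem contract_word_of_mem {j : ι} {φ : Module.Dual ℂ (Mat l)} (hφ : IsAdapted x j φ)
    {w : List ι} (hw : IsOrdered par w) (hj : j ∈ w) :
    ∃ c : ℂ, c ≠ 0 ∧
      (par j = 0 → c = w.count j * φ (x j * signMat l (wordParity par w))) ∧
      contract φ (word z w) - c • word z (w.erase j) ∈ wordSpan z 0 (w.length - 1) := by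
  induction w generalizing φ with
  | nil => simp at hj
  | cons i t ih =>
    have ht : IsOrdered par t := (List.pairwise_cons.mp hw).2
    have hit := (List.pairwise_cons.mp hw).1
    rw [word_cons, contract_mul (hz i), List.length_cons, Nat.add_sub_cancel]
    have h2 := contract_word hz (φ ∘ₗ LinearMap.mulLeft ℂ (x i)) t
    simp only [LinearMap.comp_apply, LinearMap.mulLeft_apply] at h2
    -- An even `x j` commutes with the sign matrices.
    have hcomm : par j = 0 → φ (signMat l (par i) * (x j * signMat l (wordParity par t))) =
        φ (x j * signMat l (wordParity par (i :: t))) := by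
      intro hj0
      rw [← mul_assoc, signMat_mul_part (hx j), hj0]
      simp [sgn, mul_assoc, signMat_mul, wordParity]
    by_cases hij : i = j
    · subst hij
      rw [List.erase_cons_head]
      by_cases hjt : i ∈ t
      · have hi0 : par i = 0 := by
          rcases hit i hjt with h | h
          · exact absurd h (lt_irrefl i)
          · exact h.2
        obtain ⟨c, -, hc, hmem⟩ := ih (hφ.comp_signMat hx (par i)) ht hjt
        have hc' := hc hi0
        simp only [LinearMap.comp_apply, LinearMap.mulLeft_apply] at hc'
        rw [hcomm hi0] at hc'
        have hs : signMat l (wordParity par t) = signMat l (wordParity par (i :: t)) := by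
          simp [wordParity, hi0]
        -- An ordered word that contains a lower bound of its letters starts with it.
        have ht' : z i * word z (t.erase i) = word z t := by
          rcases t with _ | ⟨k, t'⟩
          · simp at hjt
          · have hk : k = i := by
              rcases List.mem_cons.mp hjt with h | h
              · exact h.symm
              · refine le_antisymm ((List.pairwise_cons.mp ht.sorted).1 i h) ?_
                exact (List.pairwise_cons.mp hw.sorted).1 k (by simp)
            subst hk
            rw [List.erase_cons_head, word_cons]
        have hcount : c + φ (x i * signMat l (wordParity par t)) =
            ((i :: t).count i : ℂ) * φ (x i * signMat l (wordParity par (i :: t))) := by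
          rw [hc', hs, List.count_cons_self]
          push_cast
          ring
        refine ⟨c + φ (x i * signMat l (wordParity par t)), ?_, fun _ => hcount, ?_⟩
        · rw [hcount]
          refine mul_ne_zero ?_ (hφ.self _)
          rw [List.count_cons_self]
          exact Nat.cast_ne_zero.mpr (Nat.succ_ne_zero _)
        · have h3 := add_mem (gen_mul_mem_pred z i hmem) h2
          convert! h3 using 1
          rw [mul_sub, mul_smul_comm, ht', add_smul]
          abel
      · refine ⟨φ (x i * signMat l (wordParity par t)), hφ.self _, fun hi0 => ?_, ?_⟩
        · rw [List.count_cons_self, List.count_eq_zero_of_not_mem hjt]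
          simp [wordParity, hi0]
        · have h1 := contract_word_of_notMem hx hz (hφ.comp_signMat hx (par i)) hjt
          have h3 := add_mem (gen_mul_mem_pred z i h1) h2
          convert! h3 using 1
          abel
    · have hjt : j ∈ t := (List.mem_cons.mp hj).resolve_left (Ne.symm hij)
      obtain ⟨c, hc0, hc, hmem⟩ := ih (hφ.comp_signMat hx (par i)) ht hjt
      refine ⟨c, hc0, fun hj0 => ?_, ?_⟩
      · rw [hc hj0, List.count_cons_of_ne hij]
        simp only [LinearMap.comp_apply, LinearMap.mulLeft_apply]
        rw [hcomm hj0]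
      · rw [hφ.ne i hij, zero_smul, sub_zero] at h2
        have h3 := add_mem (gen_mul_mem_pred z i hmem) h2
        rw [List.erase_cons_tail (by simpa using hij), word_cons]
        convert! h3 using 1
        rw [mul_sub, mul_smul_comm]
        abel

variable (hφ : ∀ j, ∃ φ, IsAdapted x j φ)

include hφ

/-- Ordered words of a fixed length are linearly independent modulo shorter words. -/
theorem ordered_independent_mod (k : ℕ) (S : Finset (List ι)) (c : List ι → ℂ)
    (hS : ∀ w ∈ S, IsOrdered par w ∧ w.length = k)
    (h0 : ∑ w ∈ S, c w • word z w ∈ wordSpan z 0 k) : ∀ w ∈ S, c w = 0 := by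
  classical
  induction k generalizing S c with
  | zero =>
    intro w hw
    have hS' : S ⊆ {[]} := fun v hv => by
      simpa using List.length_eq_zero_iff.mp (hS v hv).2
    have hw' : w = [] := by simpa using hS' hw
    subst hw'
    have : S = {[]} := Finset.Subset.antisymm hS' (by simpa using hw)
    rw [this, wordSpan_zero, Submodule.mem_bot] at h0
    simpa using h0
  | succ k ih =>
    intro w₀ hw₀
    obtain ⟨j, t₀, rfl⟩ := List.exists_cons_of_length_eq_add_one (hS w₀ hw₀).2
    obtain ⟨φ, hφj⟩ := hφ j
    have h1 := contract_mem hz hφj.sign h0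
    choose! d hd0 hd hdmem using fun w (hw : IsOrdered par w ∧ j ∈ w) =>
      contract_word_of_mem (z := z) hx hz hφj hw.1 hw.2
    set T := S.filter (j ∈ ·) with hT
    have hTS : ∀ w ∈ T, IsOrdered par w ∧ j ∈ w ∧ w.length = k + 1 := by
      intro w hw
      obtain ⟨h2, h3⟩ := Finset.mem_filter.mp hw
      exact ⟨(hS w h2).1, h3, (hS w h2).2⟩
    have h2 : ∑ w ∈ T, (c w * d w) • word z (w.erase j) ∈ wordSpan z 0 k := by
      have h3 : ∑ w ∈ S, c w • contract φ (word z w) -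
          ∑ w ∈ T, (c w * d w) • word z (w.erase j) ∈ wordSpan z 0 k := by
        rw [hT, Finset.sum_filter, ← Finset.sum_sub_distrib]
        refine Submodule.sum_mem _ fun w hw => ?_
        have hlen := (hS w hw).2
        by_cases hjw : j ∈ w
        · have h4 : c w • contract φ (word z w) - (c w * d w) • word z (w.erase j) =
              c w • (contract φ (word z w) - d w • word z (w.erase j)) := by
            rw [mul_smul]
            exact (smul_sub (c w) _ _).symm
          rw [if_pos hjw, h4]
          have := hdmem w ⟨(hS w hw).1, hjw⟩
          rw [hlen, Nat.add_sub_cancel] at this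
          exact Submodule.smul_mem _ _ this
        · rw [if_neg hjw, sub_zero]
          have := contract_word_of_notMem hx hz hφj hjw
          rw [hlen, Nat.add_sub_cancel] at this
          exact Submodule.smul_mem _ _ this
      rw [map_sum] at h1
      simp only [map_smul] at h1
      have := sub_mem h1 h3
      rwa [sub_sub_cancel] at this
    have hinj : Set.InjOn (fun w : List ι => w.erase j) T := by
      intro v hv w hw hvw
      have hv' := hTS v hv
      have hw' := hTS w hw
      have hp : v.Perm w :=
        (List.perm_cons_erase hv'.2.1).trans
          ((show v.erase j = w.erase j from hvw) ▸ (List.perm_cons_erase hw'.2.1).symm)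
      exact hp.eq_of_pairwise' hv'.1.sorted hw'.1.sorted
    have h4 := ih (T.image fun w => w.erase j) (fun v => c (v.orderedInsert (· ≤ ·) j) *
      d (v.orderedInsert (· ≤ ·) j)) ?_ ?_ ((j :: t₀).erase j) ?_
    · rw [List.orderedInsert_erase _ _ (by simp) (hS _ hw₀).1.sorted] at h4
      exact (mul_eq_zero.mp h4).resolve_right (hd0 _ ⟨(hS _ hw₀).1, by simp⟩)
    · intro v hv
      obtain ⟨w, hw, rfl⟩ := Finset.mem_image.mp hv
      have hw' := hTS w hw
      refine ⟨List.Pairwise.sublist (List.erase_sublist) hw'.1, ?_⟩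
      rw [List.length_erase_of_mem hw'.2.1, hw'.2.2, Nat.add_sub_cancel]
    · rw [Finset.sum_image hinj]
      convert! h2 using 2 with w hw
      have hw' := hTS w hw
      rw [List.orderedInsert_erase _ _ hw'.2.1 hw'.1.sorted]
    · exact Finset.mem_image_of_mem _ (Finset.mem_filter.mpr ⟨hw₀, by simp⟩)

/-- The ordered words are linearly independent: this is the hard half of the
Poincaré–Birkhoff–Witt theorem. -/
theorem linearIndependent_ordered :
    LinearIndependent ℂ fun w : {w : List ι // IsOrdered par w} => word z w.1 := by
  classical
  rw [linearIndependent_iff']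
  intro S c h0
  by_contra! hne
  obtain ⟨w₀, hw₀, hcw₀⟩ := hne
  set T := S.filter (fun w => c w ≠ 0) with hT
  -- Compare the terms of maximal length among those with a nonzero coefficient.
  obtain ⟨w₁, hw₁, hmax⟩ := T.exists_max_image (fun w => w.1.length)
    ⟨w₀, Finset.mem_filter.mpr ⟨hw₀, hcw₀⟩⟩
  have h1 : ∑ w ∈ T, c w • word z w.1 = 0 := by
    rw [← h0, hT]
    refine Finset.sum_filter_of_ne fun w _ hw hc => hw ?_
    rw [hc, zero_smul]
  set k := w₁.1.length
  have h2 : ∑ w ∈ T.filter (fun w => w.1.length = k), c w • word z w.1 ∈ wordSpan z 0 k := by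
    rw [← Finset.sum_filter_add_sum_filter_not T (fun w => w.1.length = k)] at h1
    rw [eq_neg_of_add_eq_zero_left h1]
    refine neg_mem (Submodule.sum_mem _ fun w hw => Submodule.smul_mem _ _ ?_)
    obtain ⟨h3, h4⟩ := Finset.mem_filter.mp hw
    exact word_mem_wordSpan z (Nat.zero_le _) (lt_of_le_of_ne (hmax w h3) h4)
  have h3 := ordered_independent_mod hx hz hφ k
    ((T.filter (fun w => w.1.length = k)).image Subtype.val)
    (fun w => if hw : IsOrdered par w then c ⟨w, hw⟩ else 0) ?_ ?_ w₁.1 ?_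
  · simp only [w₁.2, dite_true] at h3
    exact (Finset.mem_filter.mp hw₁).2 h3
  · intro w hw
    obtain ⟨v, hv, rfl⟩ := Finset.mem_image.mp hw
    exact ⟨v.2, (Finset.mem_filter.mp hv).2⟩
  · rw [Finset.sum_image Subtype.val_injective.injOn]
    convert! h2 using 3 with w hw
    simp [w.2]
  · exact Finset.mem_image_of_mem _ (Finset.mem_filter.mpr ⟨hw₁, rfl⟩)

end

end Independence

end Osp

namespace Osp

/-! ### Functionals adapted to a family of homogeneous matrices -/

variable {l : ℕ}

theorem disjoint_part : Disjoint (part l 0) (part l 1) := by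
  rw [Submodule.disjoint_def]
  intro X h0 h1
  ext i j
  by_contra h
  have h2 := h0.1 i j h
  rw [h1.1 i j h, add_left_cancel_iff] at h2
  exact one_ne_zero h2

theorem iSupIndep_part : iSupIndep (part l) := by
  rw [iSupIndep_pair (zero_ne_one) (by decide)]
  exact disjoint_part

/-- The matrix without its first column. -/
def dropCol (l : ℕ) : Mat l →ₗ[ℂ] Mat l where
  toFun m := Matrix.of fun i j => Sum.elim (fun _ => 0) (fun _ => m i j) j
  map_add' m n := by ext i (j | j) <;> simp
  map_smul' c m := by ext i (j | j) <;> simp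

theorem dropCol_mul_signMat (m : Mat l) (p : ZMod 2) :
    dropCol l (m * signMat l p) = sgn 1 p • dropCol l m := by
  ext i (j | j)
  · simp [dropCol]
  · simp [dropCol, signMat, parity, mul_comm]

/-- Without their first column, the elements of `osp(1,2l)` are still determined, even modulo the
identity matrix. -/
theorem eq_zero_of_dropCol (hl : 1 ≤ l) {y : Mat l} (hy : y ∈ ⨆ p, part l p) {a : ℂ}
    (h : dropCol l y = a • dropCol l 1) : y = 0 := by
  have hsup : (⨆ p, part l p) = part l 0 ⊔ part l 1 := by
    apply le_antisymm
    · refine iSup_le fun p => ?_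
      have : p = 0 ∨ p = 1 := by revert p; decide
      rcases this with rfl | rfl
      · exact le_sup_left
      · exact le_sup_right
    · exact sup_le (le_iSup (part l) 0) (le_iSup (part l) 1)
  rw [hsup] at hy
  obtain ⟨y0, h0, y1, h1, rfl⟩ := Submodule.mem_sup.mp hy
  have e0 : ∀ i j, y0 (.inl i) (.inr j) = 0 := fun i j =>
    part_apply_eq_zero h0 (by simp [parity])
  have e0' : ∀ i j, y0 (.inr i) (.inl j) = 0 := fun i j =>
    part_apply_eq_zero h0 (by simp [parity])
  have e1 : ∀ i j, y1 (.inr i) (.inr j) = 0 := fun i j =>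
    part_apply_eq_zero h1 (by simp [parity])
  have hy1 : y1 = 0 := by
    apply odd_eq_zero h1
    intro j
    have := congrFun (congrFun h (.inl ())) (.inr j)
    simpa [dropCol, e0] using this
  have hy0 : ∀ i j, y0 (.inr i) (.inr j) = a * (1 : Matrix (Fin l ⊕ Fin l) _ ℂ) i j := by
    intro i j
    have := congrFun (congrFun h (.inr i)) (.inr j)
    simpa [dropCol, e1, Matrix.one_apply] using this
  have ha : a = 0 := by
    let k : Fin l := ⟨0, hl⟩
    have h2 := h0.2 (.inr (.inl k)) (.inr (.inr k))
    simp only [Matrix.mul_apply, Fintype.sum_sum_type, form, Matrix.fromBlocks_apply₁₂,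
      Matrix.fromBlocks_apply₂₁, Matrix.fromBlocks_apply₂₂, Matrix.zero_apply,
      Matrix.transpose_apply, mul_zero, zero_mul, Finset.sum_const_zero, zero_add, hy0] at h2
    simp [Matrix.J, Matrix.one_apply, sgn] at h2
    exact h2
  rw [hy1, add_zero]
  ext i j
  rcases i with ⟨⟩ | i <;> rcases j with ⟨⟩ | j
  · have h2 := h0.2 (.inl ()) (.inl ())
    simp only [Matrix.mul_apply, Fintype.sum_sum_type, form, Matrix.fromBlocks_apply₁₁,
      Matrix.fromBlocks_apply₁₂, Matrix.fromBlocks_apply₂₁, Matrix.zero_apply,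
      Matrix.transpose_apply, mul_zero, zero_mul, Finset.sum_const_zero, add_zero] at h2
    simp [sgn] at h2
    exact h2
  · exact e0 _ _
  · exact e0' _ _
  · rw [hy0, ha, zero_mul]; rfl

theorem exists_isAdapted (hl : 1 ≤ l) {ι : Type*} {par : ι → ZMod 2} {x : ι → Mat l}
    (hx : ∀ i, x i ∈ part l (par i)) (hlin : LinearIndependent ℂ x) (j : ι) :
    ∃ φ, IsAdapted x j φ := by
  set N : Submodule ℂ (Mat l) := Submodule.span ℂ {dropCol l 1} ⊔
    (Submodule.span ℂ (x '' {i | i ≠ j})).map (dropCol l) with hN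
  have hxmem : ∀ i, x i ∈ ⨆ p, part l p := fun i => le_iSup (part l) (par i) (hx i)
  have hj : dropCol l (x j) ∉ N := by
    intro hmem
    obtain ⟨u, hu, v, hv, huv⟩ := Submodule.mem_sup.mp hmem
    obtain ⟨a, rfl⟩ := Submodule.mem_span_singleton.mp hu
    obtain ⟨k, hk, rfl⟩ := Submodule.mem_map.mp hv
    have hk' : k ∈ ⨆ p, part l p :=
      Submodule.span_le.mpr (by rintro _ ⟨i, -, rfl⟩; exact hxmem i) hk
    have h1 := eq_zero_of_dropCol hl (sub_mem (hxmem j) hk') (a := a)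
      (by rw [map_sub, ← huv, add_sub_cancel_right])
    rw [sub_eq_zero] at h1
    rw [← h1] at hk
    exact hlin.notMem_span_image (s := {i | i ≠ j}) (by simp) hk
  obtain ⟨f, hf, hle⟩ := Submodule.exists_le_ker_of_notMem hj
  have h1 : f (dropCol l 1) = 0 :=
    hle (Submodule.mem_sup_left (Submodule.mem_span_singleton_self _))
  refine ⟨f ∘ₗ dropCol l, fun p => ?_, fun i hi p => ?_, fun p => ?_⟩
  · have := dropCol_mul_signMat (1 : Mat l) p
    rw [one_mul] at this
    rw [LinearMap.comp_apply, this, map_smul, h1, smul_zero]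
  · rw [LinearMap.comp_apply, dropCol_mul_signMat, map_smul]
    have : f (dropCol l (x i)) = 0 :=
      hle (Submodule.mem_sup_right (Submodule.mem_map_of_mem
        (Submodule.subset_span ⟨i, hi, rfl⟩)))
    rw [this, smul_zero]
  · rw [LinearMap.comp_apply, dropCol_mul_signMat, map_smul, smul_eq_mul]
    refine mul_ne_zero ?_ hf
    unfold sgn
    split_ifs <;> norm_num

/-! ### A basis of weight vectors -/

variable (h : LieSubalgebra ℂ (even l))

instance moduleFree_submodule_part (p : ZMod 2) (S : Submodule ℂ (part l p)) : Module.Free ℂ S :=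
  Module.Free.of_equiv (S.equivMapOfInjective _ (part l p).injective_subtype).symm

/-- The index set of a basis of weight vectors. -/
structure WeightIdx where
  /-- The parity of the basis vector. -/
  parity : ZMod 2
  /-- The weight of the basis vector. -/
  weight : Module.Dual ℂ h
  /-- The position in a basis of the weight space. -/
  pos : Fin (Module.finrank ℂ (rootSpace h parity weight))

variable {h}

/-- The weight vectors that make up the basis. -/
def weightVec (i : WeightIdx h) : part l i.parity :=
  (Module.finBasis ℂ (rootSpace h i.parity i.weight) i.pos : rootSpace h i.parity i.weight)

theorem weightVec_mem (i : WeightIdx h) : weightVec i ∈ rootSpace h i.parity i.weight :=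
  Subtype.property _

theorem weightVec_ne_zero (i : WeightIdx h) : weightVec i ≠ 0 := by
  have := (Module.finBasis ℂ (rootSpace h i.parity i.weight)).ne_zero i.pos
  simpa [weightVec] using this

theorem eq_sum_weightVec {p : ZMod 2} {α : Module.Dual ℂ h} {x : part l p}
    (hx : x ∈ rootSpace h p α) : ∃ r : Fin (Module.finrank ℂ (rootSpace h p α)) → ℂ,
      x = ∑ a, r a • weightVec (⟨p, α, a⟩ : WeightIdx h) := by
  refine ⟨fun a => (Module.finBasis ℂ (rootSpace h p α)).repr ⟨x, hx⟩ a, ?_⟩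
  have h1 := congrArg (rootSpace h p α).subtype
    ((Module.finBasis ℂ (rootSpace h p α)).sum_repr ⟨x, hx⟩)
  rw [map_sum] at h1
  exact h1.symm

variable [h.IsCartanSubalgebra]

theorem _root_.DFinsupp.basis_apply {ι : Type*} [DecidableEq ι] {R : Type*} {M : ι → Type*} [Semiring R]
    [∀ i, AddCommMonoid (M i)] [∀ i, Module R (M i)] {η : ι → Type*}
    (b : ∀ i, Module.Basis (η i) R (M i)) (i : Σ i, η i) :
    DFinsupp.basis b i = DFinsupp.single i.1 (b i.1 i.2) := by
  rw [Module.Basis.apply_eq_iff]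
  obtain ⟨i, a⟩ := i
  classical
  ext ⟨j, c⟩
  by_cases h : i = j
  · subst h
    by_cases h2 : a = c
    · subst h2; simp [DFinsupp.basis]
    · simp [DFinsupp.basis, h2]
  · simp [DFinsupp.basis, h]

theorem linearIndependent_weightVec :
    LinearIndependent ℂ fun i : WeightIdx h => (weightVec i : Mat l) := by
  classical
  let b (p : ZMod 2) := (isInternal_rootSpace h p).collectedBasis
    fun α => Module.finBasis ℂ (rootSpace h p α)
  have h1 : LinearIndependent ℂ (DFinsupp.basis b) := (DFinsupp.basis b).linearIndependent
  let f : (Π₀ p, part l p) →ₗ[ℂ] Mat l := DFinsupp.lsum ℂ fun p => (part l p).subtype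
  have hf : Function.Injective f := iSupIndep_part.dfinsupp_lsum_injective
  have h2 := h1.map_injOn f hf.injOn
  let g (i : WeightIdx h) : Σ p : ZMod 2, Σ α : Module.Dual ℂ h,
    Fin (Module.finrank ℂ (rootSpace h p α)) := ⟨i.parity, i.weight, i.pos⟩
  have hg : Function.Injective g := by
    rintro ⟨p, α, a⟩ ⟨q, β, b⟩ h3
    simp only [g, Sigma.mk.injEq] at h3
    obtain ⟨rfl, h3⟩ := h3
    simp only [heq_eq_eq, Sigma.mk.injEq] at h3
    obtain ⟨rfl, h3⟩ := h3
    rw [eq_of_heq h3]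
  convert! h2.comp g hg using 1
  ext1 i
  rw [Function.comp_apply, Function.comp_apply, DFinsupp.basis_apply]
  have h3 : f (DFinsupp.single i.parity (b i.parity ⟨i.weight, i.pos⟩)) =
      b i.parity ⟨i.weight, i.pos⟩ := DFinsupp.lsum_single ℂ _ _ _
  rw [h3]
  simp [weightVec, b]

theorem gen_mem_span_weightVec {p : ZMod 2} (x : part l p) :
    gen l p x ∈ Submodule.span ℂ (Set.range fun i : WeightIdx h => gen l i.parity (weightVec i)) := by
  have hx : x ∈ ⨆ α, rootSpace h p α := by rw [iSup_rootSpace]; trivial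
  induction hx using Submodule.iSup_induction' with
  | mem α x hx =>
    obtain ⟨r, rfl⟩ := eq_sum_weightVec hx
    rw [map_sum]
    refine Submodule.sum_mem _ fun a _ => ?_
    rw [map_smul]
    exact Submodule.smul_mem _ _ (Submodule.subset_span ⟨⟨p, α, a⟩, rfl⟩)
  | zero => rw [map_zero]; exact zero_mem _
  | add x y _ _ hx hy => rw [map_add]; exact add_mem hx hy

end Osp

namespace Osp

/-! ### The generators shifted by a weight -/

variable {l : ℕ} {h : LieSubalgebra ℂ (even l)}

theorem bracket_mem_rootSpace {p q : ZMod 2} {α β : Module.Dual ℂ h} {x : part l p} {y : part l q}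
    (hx : x ∈ rootSpace h p α) (hy : y ∈ rootSpace h q β) :
    bracket x y ∈ rootSpace h (p + q) (α + β) := by
  intro H
  have h1 := hx H
  have h2 := hy H
  set a : Mat l := ((ofCartan H : part l 0) : Mat l)
  have e : ((bracket x y : part l (p + q)) : Mat l) =
    (x : Mat l) * y - sgn p q • ((y : Mat l) * x) := rfl
  have h3 : a * (x : Mat l) = (x : Mat l) * a + α H • (x : Mat l) := by rw [← h1]; abel
  have h4 : a * (y : Mat l) = (y : Mat l) * a + β H • (y : Mat l) := by rw [← h2]; abel
  rw [e, mul_sub, sub_mul, mul_smul_comm, smul_mul_assoc, ← mul_assoc, ← mul_assoc, h3, h4,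
    add_mul, add_mul, mul_assoc, mul_assoc, h3, h4, LinearMap.add_apply]
  simp only [mul_add, smul_mul_assoc, mul_smul_comm, add_smul, smul_sub, smul_add, mul_assoc]
  simp only [smul_comm (sgn p q)]
  abel

variable [h.IsCartanSubalgebra]

theorem ofCartan_mem_rootSpace (H : h) : (ofCartan H : part l 0) ∈ rootSpace h 0 0 := by
  intro K
  rw [LinearMap.zero_apply, zero_smul]
  exact sub_eq_zero.mpr (cartan_commute h K H).eq

theorem parity_eq_zero_of_weight_eq_zero {i : WeightIdx h} (hi : i.weight = 0) : i.parity = 0 := by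
  by_contra hp
  have hp1 : i.parity = 1 := by
    revert hp
    generalize i.parity = p
    revert p
    decide
  obtain ⟨p, α, a⟩ := i
  simp only at hp1 hi
  subst hp1
  have h1 : α = 0 := hi
  subst h1
  have h2 := weightVec_mem (⟨1, 0, a⟩ : WeightIdx h)
  rw [rootSpace_one_zero, Submodule.mem_bot] at h2
  exact weightVec_ne_zero _ h2

open Classical in
/-- The element of the Cartan subalgebra given by a basis vector of weight zero; zero for the other
basis vectors. -/
def cartanElt (i : WeightIdx h) : h :=
  if hi : i.weight = 0 ∧ ∃ H : h, ((H : even l) : Mat l) = weightVec i then hi.2.choose else 0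

omit [h.IsCartanSubalgebra] in
theorem cartanElt_of_ne {i : WeightIdx h} (hi : i.weight ≠ 0) : cartanElt i = 0 :=
  dif_neg fun h' => hi h'.1

theorem coe_cartanElt {i : WeightIdx h} (hi : i.weight = 0) :
    ((cartanElt i : even l) : Mat l) = weightVec i := by
  have hex : ∃ H : h, ((H : even l) : Mat l) = weightVec i := by
    have hp := parity_eq_zero_of_weight_eq_zero hi
    obtain ⟨p, α, a⟩ := i
    simp only at hp
    subst hp
    have h1 : α = 0 := hi
    subst h1
    exact ⟨⟨_, mem_cartan_of_mem_rootSpace_zero h (weightVec_mem (⟨0, 0, a⟩ : WeightIdx h))⟩, rfl⟩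
  have h2 : i.weight = 0 ∧ ∃ H : h, ((H : even l) : Mat l) = weightVec i := ⟨hi, hex⟩
  rw [cartanElt, dif_pos h2]
  exact h2.2.choose_spec

/-- The generator of the enveloping algebra given by a basis vector, shifted by the value of `lam`
if the basis vector lies in the Cartan subalgebra. -/
def shiftedGen (lam : Module.Dual ℂ h) (i : WeightIdx h) : Env l :=
  gen l i.parity (weightVec i) - algebraMap ℂ (Env l) (lam (cartanElt i))

variable (lam : Module.Dual ℂ h)

omit [h.IsCartanSubalgebra] in
theorem shiftedGen_of_ne {i : WeightIdx h} (hi : i.weight ≠ 0) :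
    shiftedGen lam i = gen l i.parity (weightVec i) := by
  rw [shiftedGen, cartanElt_of_ne hi, map_zero, map_zero, sub_zero]

open scoped TensorProduct

theorem coprod_shiftedGen (i : WeightIdx h) :
    coprod l (shiftedGen lam i) =
      shiftedGen lam i ⊗ₜ signMat l i.parity + 1 ⊗ₜ (weightVec i : Mat l) := by
  by_cases hi : i.weight = 0
  · have hs : signMat l i.parity = 1 := by
      rw [parity_eq_zero_of_weight_eq_zero hi, signMat_zero]
    rw [shiftedGen, map_sub, coprod_gen, AlgHom.commutes, TensorProduct.sub_tmul, hs,
      Algebra.TensorProduct.algebraMap_apply]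
    abel
  · rw [shiftedGen_of_ne lam hi, coprod_gen]

theorem linearIndependent_shifted (hl : 1 ≤ l) [LinearOrder (WeightIdx h)] :
    LinearIndependent ℂ fun w : {w : List (WeightIdx h) // IsOrdered WeightIdx.parity w} =>
      word (shiftedGen lam) w.1 := by
  let x : WeightIdx h → Mat l := fun i => (weightVec i : Mat l)
  have hx : ∀ i, x i ∈ part l (i.parity) := fun i => (weightVec i).2
  have hlin : LinearIndependent ℂ x := linearIndependent_weightVec
  have hφ : ∀ j, ∃ φ, IsAdapted x j φ := fun j => exists_isAdapted hl hx hlin j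
  have hz : ∀ i, coprod l (shiftedGen lam i) =
      shiftedGen lam i ⊗ₜ signMat l (i.parity) + 1 ⊗ₜ x i := coprod_shiftedGen lam
  exact linearIndependent_ordered hx hz hφ

/-- The shifts by scalars do not affect supercommutators. -/
theorem shiftedGen_supercomm (i j : WeightIdx h) :
    shiftedGen lam i * shiftedGen lam j - sgn i.parity j.parity • (shiftedGen lam j * shiftedGen lam i) =
      gen l (i.parity + j.parity) (bracket (weightVec i) (weightVec j)) := by
  have h1 := gen_mul_gen (weightVec i) (weightVec j)
  by_cases hi : i.weight = 0
  · have hs : sgn i.parity j.parity = 1 := by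
      rw [parity_eq_zero_of_weight_eq_zero hi]; simp [sgn]
    rw [hs, one_smul] at h1 ⊢
    simp only [shiftedGen, Algebra.algebraMap_eq_smul_one, sub_mul, mul_sub, h1, smul_mul_assoc,
      mul_smul_comm, one_mul, mul_one]
    module
  · by_cases hj : j.weight = 0
    · have hs : sgn i.parity j.parity = 1 := by
        rw [parity_eq_zero_of_weight_eq_zero hj]; simp [sgn]
      rw [hs, one_smul] at h1 ⊢
      simp only [shiftedGen, Algebra.algebraMap_eq_smul_one, sub_mul, mul_sub, h1, smul_mul_assoc,
        mul_smul_comm, one_mul, mul_one]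
      module
    · rw [shiftedGen_of_ne lam hi, shiftedGen_of_ne lam hj, h1, add_sub_cancel_left]

theorem gen_mem_wordSpan {p : ZMod 2} (x : part l p) :
    gen l p x ∈ wordSpan (shiftedGen lam) 0 2 := by
  refine (Submodule.span_le.mpr ?_) (gen_mem_span_weightVec (h := h) x)
  rintro _ ⟨i, rfl⟩
  have h1 : gen l i.parity (weightVec i) =
      word (shiftedGen lam) [i] + lam (cartanElt i) • word (shiftedGen lam) [] := by
    simp [shiftedGen, Algebra.algebraMap_eq_smul_one]
  simp only
  rw [h1]
  exact add_mem (word_mem_wordSpan _ (by simp) (by simp))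
    (Submodule.smul_mem _ _ (word_mem_wordSpan _ (by simp) (by simp)))

theorem Env.induction {C : Env l → Prop} (hgen : ∀ p x, C (gen l p x))
    (halg : ∀ r, C (algebraMap ℂ (Env l) r)) (hadd : ∀ u v, C u → C v → C (u + v))
    (hmul : ∀ u v, C u → C v → C (u * v)) (u : Env l) : C u := by
  obtain ⟨t, rfl⟩ := RingQuot.mkAlgHom_surjective ℂ (Rel l) u
  induction t using TensorAlgebra.induction with
  | algebraMap r => rw [AlgHom.commutes]; exact halg r
  | ι x =>
    induction x using DirectSum.induction_on with
    | zero => simpa using halg 0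
    | of p x => exact hgen p x
    | add x y hx hy => rw [map_add, map_add]; exact hadd _ _ hx hy
  | mul a b ha hb => rw [map_mul]; exact hmul _ _ ha hb
  | add a b ha hb => rw [map_add]; exact hadd _ _ ha hb

theorem mem_span_words (u : Env l) :
    u ∈ Submodule.span ℂ (Set.range (word (shiftedGen lam))) := by
  set W := Submodule.span ℂ (Set.range (word (shiftedGen lam))) with hW
  have hmul : ∀ u ∈ W, ∀ v ∈ W, u * v ∈ W := by
    intro u hu v hv
    have h1 : W * W ≤ W := by
      rw [hW, Submodule.span_mul_span]
      refine Submodule.span_mono ?_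
      rintro _ ⟨_, ⟨v, rfl⟩, _, ⟨w, rfl⟩, rfl⟩
      exact ⟨v ++ w, word_append _ _ _⟩
    exact h1 (Submodule.mul_mem_mul hu hv)
  have hone : (1 : Env l) ∈ W := Submodule.subset_span ⟨[], rfl⟩
  have hle : wordSpan (shiftedGen lam) 0 2 ≤ W := Submodule.span_mono (Set.image_subset_range _ _)
  induction u using Env.induction with
  | hgen p x => exact hle (gen_mem_wordSpan lam x)
  | halg r => rw [Algebra.algebraMap_eq_smul_one]; exact W.smul_mem r hone
  | hadd u v hu hv => exact add_mem hu hv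
  | hmul u v hu hv => exact hmul _ hu _ hv

theorem mem_span_ordered [LinearOrder (WeightIdx h)] (u : Env l) :
    u ∈ Submodule.span ℂ (word (shiftedGen lam) '' {w | IsOrdered WeightIdx.parity w}) := by
  refine (Submodule.span_le.mpr ?_) (mem_span_words lam u)
  rintro _ ⟨w, rfl⟩
  have h1 := wordSpan_le_ordered WeightIdx.parity (shiftedGen lam) (m := 0)
    (fun i j => by rw [shiftedGen_supercomm]; exact gen_mem_wordSpan lam _) (w.length + 1)
    (word_mem_wordSpan _ (Nat.zero_le _) (Nat.lt_succ_self _))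
  refine Submodule.span_mono (Set.image_mono ?_) h1
  exact fun v hv => hv.1

end Osp

namespace Osp

/-! ### The annihilators of the Verma modules -/

variable {l : ℕ}

theorem parityAut_gen {p : ZMod 2} (x : part l p) :
    parityAut l (gen l p x) = sgn p 1 • gen l p x := by
  simp [parityAut, gen]

theorem parityAut_parityAut (u : Env l) : parityAut l (parityAut l u) = u := by
  induction u using Env.induction with
  | hgen p x => rw [parityAut_gen, map_smul, parityAut_gen, smul_smul, sgn_mul_self, one_smul]
  | halg r => rw [AlgHom.commutes, AlgHom.commutes]
  | hadd u v hu hv => rw [map_add, map_add, hu, hv]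
  | hmul u v hu hv => rw [map_mul, map_mul, hu, hv]

/-- The left ideal generated by an `ad`-invariant subspace and its image under the parity
automorphism is a right ideal as well. The subspace itself need not be graded. -/
theorem mul_mem_span_of_adInvariant {V : Submodule ℂ (Env l)} (hV : AdInvariant V) {q : Env l}
    (hq : q ∈ Ideal.span ((V : Set (Env l)) ∪ parityAut l '' V)) (u : Env l) :
    q * u ∈ Ideal.span ((V : Set (Env l)) ∪ parityAut l '' V) := by
  set Q := Ideal.span ((V : Set (Env l)) ∪ parityAut l '' V)
  have h1 : ∀ v ∈ V, v ∈ Q := fun v hv => Ideal.subset_span (.inl hv)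
  have h2 : ∀ v ∈ V, parityAut l v ∈ Q := fun v hv => Ideal.subset_span (.inr ⟨v, hv, rfl⟩)
  induction u using Env.induction generalizing q with
  | hgen p x =>
    have key : ∀ v ∈ V, v * gen l p x ∈ Q ∧ parityAut l v * gen l p x ∈ Q := by
      intro v hv
      have h3 := hV p x v hv
      have hp : ∀ p : ZMod 2, p = 0 ∨ p = 1 := by decide
      rcases hp p with rfl | rfl
      · have e1 : v * gen l 0 x = gen l 0 x * v - ad x v := by simp [ad]
        have e2 : parityAut l v * gen l 0 x =
            gen l 0 x * parityAut l v - parityAut l (ad x v) := by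
          simp [ad, parityAut_gen, sgn]
        rw [e1, e2]
        exact ⟨sub_mem (Ideal.mul_mem_left _ _ (h1 v hv)) (h1 _ h3),
          sub_mem (Ideal.mul_mem_left _ _ (h2 v hv)) (h2 _ h3)⟩
      · have e1 : v * gen l 1 x = gen l 1 x * parityAut l v + parityAut l (ad x v) := by
          simp [ad, parityAut_gen, sgn, parityAut_parityAut]
          module
        have e2 : parityAut l v * gen l 1 x = gen l 1 x * v - ad x v := by simp [ad]
        rw [e1, e2]
        exact ⟨add_mem (Ideal.mul_mem_left _ _ (h2 v hv)) (h2 _ h3),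
          sub_mem (Ideal.mul_mem_left _ _ (h1 v hv)) (h1 _ h3)⟩
    induction hq using Submodule.span_induction with
    | mem y hy =>
      rcases hy with hy | ⟨v, hv, rfl⟩
      · exact (key y hy).1
      · exact (key v hv).2
    | zero => simp
    | add y y' _ _ hy hy' => rw [add_mul]; exact add_mem hy hy'
    | smul a y _ hy => rw [smul_eq_mul, mul_assoc]; exact Ideal.mul_mem_left _ _ hy
  | halg r => rw [← Algebra.commutes]; exact Ideal.mul_mem_left _ _ hq
  | hadd u v hu hv => rw [mul_add]; exact add_mem (hu hq) (hv hq)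
  | hmul u v hu hv => rw [← mul_assoc]; exact hv (hu hq)

variable {h : LieSubalgebra ℂ (even l)} (π : Set (Module.Dual ℂ h)) (lam : Module.Dual ℂ h)

theorem parityAut_mem_vermaIdeal {u : Env l} (hu : u ∈ vermaIdeal h π lam) :
    parityAut l u ∈ vermaIdeal h π lam := by
  have h1 : vermaIdeal h π lam ≤ (vermaIdeal h π lam).comap (parityAut l) := by
    refine Ideal.span_le.mpr ?_
    rintro _ (⟨α, hα, p, x, hx, rfl⟩ | ⟨H, rfl⟩)
    · change parityAut l _ ∈ vermaIdeal h π lam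
      rw [parityAut_gen]
      exact Submodule.smul_of_tower_mem _ _ (Ideal.subset_span (.inl ⟨α, hα, p, x, hx, rfl⟩))
    · change parityAut l _ ∈ vermaIdeal h π lam
      rw [map_sub, AlgHom.commutes, parityAut_gen]
      simp only [sgn, zero_ne_one, false_and, if_false, one_smul]
      exact Ideal.subset_span (.inr ⟨H, rfl⟩)
  exact h1 hu

/-- An `ad`-invariant subspace annihilates a Verma module as soon as it annihilates the highest
weight vector. -/
theorem subset_annihilator_iff {V : Submodule ℂ (Env l)} (hV : AdInvariant V) :
    (V : Set (Env l)) ⊆ Module.annihilator (Env l) (Verma h π lam) ↔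
      ∀ v ∈ V, v ∈ vermaIdeal h π lam := by
  constructor
  · intro h1 v hv
    have h2 := Module.mem_annihilator.mp (h1 hv) (Submodule.Quotient.mk 1)
    rw [← Submodule.Quotient.mk_smul, Submodule.Quotient.mk_eq_zero, smul_eq_mul, mul_one] at h2
    exact h2
  · intro h1 v hv
    refine Module.mem_annihilator.mpr fun m => ?_
    obtain ⟨u, rfl⟩ := Submodule.Quotient.mk_surjective _ m
    rw [← Submodule.Quotient.mk_smul, Submodule.Quotient.mk_eq_zero, smul_eq_mul]
    have h2 : Ideal.span ((V : Set (Env l)) ∪ parityAut l '' V) ≤ vermaIdeal h π lam := by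
      refine Ideal.span_le.mpr ?_
      rintro _ (hy | ⟨y, hy, rfl⟩)
      · exact h1 _ hy
      · exact parityAut_mem_vermaIdeal π lam (h1 y hy)
    exact h2 (mul_mem_span_of_adInvariant hV (Ideal.subset_span (.inl hv)) u)

/-! ### A basis of the Verma modules -/

variable {π}

/-- Nonzero sums of simple roots have no additive inverse among such sums. -/
theorem eq_zero_of_add_eq_zero_of_mem_closure {W : Type*} [AddCommGroup W] [Module ℂ W]
    {π : Set W} (hπ : LinearIndepOn ℂ id π) {α β : W} (hα : α ∈ AddSubmonoid.closure π)
    (hβ : β ∈ AddSubmonoid.closure π) (hαβ : α + β = 0) : α = 0 := by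
  obtain ⟨f, hf⟩ : ∃ f : Module.Dual ℂ W, ∀ a ∈ π, f a = 1 := by
    refine ⟨(Module.Basis.extend hπ).constr ℂ fun _ => 1, fun a ha => ?_⟩
    have h1 := (Module.Basis.extend hπ).constr_basis ℂ (fun _ => (1 : ℂ))
      ⟨a, hπ.subset_extend (Set.subset_univ _) ha⟩
    rwa [Module.Basis.extend_apply_self] at h1
  -- The height of a sum of simple roots.
  have key : ∀ γ ∈ AddSubmonoid.closure π, ∃ n : ℕ, f γ = n ∧ (n = 0 → γ = 0) := by
    intro γ hγ
    induction hγ using AddSubmonoid.closure_induction with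
    | mem x hx => exact ⟨1, by simp [hf x hx], by simp⟩
    | zero => exact ⟨0, by simp, fun _ => rfl⟩
    | add x y _ _ hx hy =>
      obtain ⟨m, hm, hm'⟩ := hx
      obtain ⟨n, hn, hn'⟩ := hy
      refine ⟨m + n, by simp [hm, hn], fun h0 => ?_⟩
      rw [hm' (by omega), hn' (by omega), add_zero]
  obtain ⟨m, hm, hm'⟩ := key α hα
  obtain ⟨n, hn, -⟩ := key β hβ
  have h1 : (m : ℂ) + n = 0 := by rw [← hm, ← hn, ← map_add, hαβ, map_zero]
  have h2 : m + n = 0 := by exact_mod_cast h1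
  exact hm' (by omega)

variable (π) in
/-- The basis vectors in the Borel subalgebra `b⁺`. -/
def IsBorel (i : WeightIdx h) : Prop := i.weight ∈ AddSubmonoid.closure π

theorem weight_ne_zero_of_not_isBorel {i : WeightIdx h} (hi : ¬ IsBorel π i) : i.weight ≠ 0 :=
  fun h0 => hi (by rw [IsBorel, h0]; exact zero_mem _)

variable [h.IsCartanSubalgebra]

theorem shiftedGen_mem_vermaIdeal {i : WeightIdx h} (hi : IsBorel π i) :
    shiftedGen lam i ∈ vermaIdeal h π lam := by
  by_cases h0 : i.weight = 0
  · have hp := parity_eq_zero_of_weight_eq_zero h0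
    have h1 : gen l i.parity (weightVec i) = gen l 0 (ofCartan (cartanElt i)) := by
      have h2 := coe_cartanElt h0
      generalize cartanElt i = H at h2
      generalize weightVec i = x at h2
      obtain ⟨p, α, a⟩ := i
      simp only at hp
      subst hp
      exact congrArg _ (Subtype.ext h2.symm)
    rw [shiftedGen, h1]
    exact Ideal.subset_span (.inr ⟨_, rfl⟩)
  · rw [shiftedGen_of_ne lam h0]
    refine Ideal.subset_span (.inl ⟨i.weight, ⟨⟨h0, i.parity, ?_⟩, hi⟩, i.parity, _, weightVec_mem i, rfl⟩)
    intro hbot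
    have h1 := weightVec_mem i
    rw [hbot, Submodule.mem_bot] at h1
    exact weightVec_ne_zero i h1

omit [h.IsCartanSubalgebra] in
theorem gen_eq_sum_shiftedGen {p : ZMod 2} {α : Module.Dual ℂ h} (hα : α ≠ 0) {x : part l p}
    (hx : x ∈ rootSpace h p α) : ∃ r : Fin (Module.finrank ℂ (rootSpace h p α)) → ℂ,
      gen l p x = ∑ a, r a • shiftedGen lam (⟨p, α, a⟩ : WeightIdx h) := by
  obtain ⟨r, rfl⟩ := eq_sum_weightVec hx
  refine ⟨r, ?_⟩
  rw [map_sum]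
  refine Finset.sum_congr rfl fun a _ => ?_
  rw [shiftedGen_of_ne lam hα, map_smul]

theorem vermaIdeal_le : vermaIdeal h π lam ≤ Ideal.span (shiftedGen lam '' {i | IsBorel π i}) := by
  have hmem : ∀ i : WeightIdx h, IsBorel π i →
      shiftedGen lam i ∈ Ideal.span (shiftedGen lam '' {i | IsBorel π i}) :=
    fun i hi => Ideal.subset_span ⟨i, hi, rfl⟩
  refine Ideal.span_le.mpr ?_
  rintro _ (⟨α, hα, p, x, hx, rfl⟩ | ⟨H, rfl⟩)
  · obtain ⟨r, hr⟩ := gen_eq_sum_shiftedGen lam hα.1.1 hx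
    rw [SetLike.mem_coe, hr]
    exact Submodule.sum_mem _ fun a _ => Submodule.smul_of_tower_mem _ _ (hmem ⟨p, α, a⟩ hα.2)
  · obtain ⟨r, hr⟩ := eq_sum_weightVec (ofCartan_mem_rootSpace H)
    have hH : H = ∑ a, r a • cartanElt (⟨0, 0, a⟩ : WeightIdx h) := by
      let f : h →ₗ[ℂ] Mat l := (even l).subtype.comp h.subtype
      have hf : Function.Injective f := fun _ _ h1 => Subtype.ext (Subtype.ext h1)
      apply hf
      have h1 := congrArg (part l 0).subtype hr
      rw [map_sum] at h1 ⊢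
      refine h1.trans (Finset.sum_congr rfl fun a _ => ?_)
      rw [map_smul, map_smul]
      exact congrArg _ (coe_cartanElt (i := (⟨0, 0, a⟩ : WeightIdx h)) rfl).symm
    have h2 : gen l 0 (ofCartan H) - algebraMap ℂ (Env l) (lam H) =
        ∑ a, r a • shiftedGen lam (⟨0, 0, a⟩ : WeightIdx h) := by
      rw [hr]
      conv_lhs => rw [hH]
      rw [map_sum, map_sum, map_sum, ← Finset.sum_sub_distrib]
      refine Finset.sum_congr rfl fun a _ => ?_
      simp only [shiftedGen, map_smul, Algebra.algebraMap_eq_smul_one, smul_eq_mul, mul_smul]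
      module
    rw [SetLike.mem_coe, h2]
    exact Submodule.sum_mem _ fun a _ =>
      Submodule.smul_of_tower_mem _ _ (hmem ⟨0, 0, a⟩ (zero_mem _))

/-- The supercommutators of the shifted generators of the Borel subalgebra involve no constants:
the character of the Borel subalgebra vanishes on supercommutators. -/
theorem shiftedGen_supercomm_mem (hπ : LinearIndepOn ℂ id π) (i j : {i : WeightIdx h // IsBorel π i}) :
    shiftedGen lam i.1 * shiftedGen lam j.1 -
      sgn (i.1.parity) (j.1.parity) • (shiftedGen lam j.1 * shiftedGen lam i.1) ∈
      wordSpan (fun k : {i : WeightIdx h // IsBorel π i} => shiftedGen lam k.1) 1 2 := by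
  rw [shiftedGen_supercomm]
  by_cases h0 : i.1.weight + j.1.weight = 0
  · have hi := eq_zero_of_add_eq_zero_of_mem_closure hπ i.2 j.2 h0
    have hj : j.1.weight = 0 := by rwa [hi, zero_add] at h0
    have hb : bracket (weightVec i.1) (weightVec j.1) = 0 := by
      apply Subtype.ext
      have hs : sgn i.1.parity j.1.parity = 1 := by
        rw [parity_eq_zero_of_weight_eq_zero hi]; simp [sgn]
      change (weightVec i.1 : Mat l) * weightVec j.1 -
        sgn i.1.parity j.1.parity • ((weightVec j.1 : Mat l) * weightVec i.1) = 0
      rw [hs, one_smul, ← coe_cartanElt hi, ← coe_cartanElt hj, (cartan_commute h _ _).eq, sub_self]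
    rw [hb, map_zero]
    exact zero_mem _
  · have hmem := bracket_mem_rootSpace (weightVec_mem i.1) (weightVec_mem j.1)
    obtain ⟨r, hr⟩ := gen_eq_sum_shiftedGen lam h0 hmem
    rw [hr]
    refine Submodule.sum_mem _ fun a _ => Submodule.smul_mem _ _ ?_
    have h1 := word_mem_wordSpan
      (fun k : {i : WeightIdx h // IsBorel π i} => shiftedGen lam k.1) (m := 1) (k := 2)
      (w := [⟨⟨i.1.parity + j.1.parity, i.1.weight + j.1.weight, a⟩, add_mem i.2 j.2⟩]) (by simp) (by simp)
    simpa using h1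

section Order

variable [LinearOrder (WeightIdx h)]
  (hord : ∀ i j : WeightIdx h, ¬ IsBorel π i → IsBorel π j → i < j)

include hord

omit [h.IsCartanSubalgebra] in
open Classical in
theorem IsOrdered.eq_filter_append {w : List (WeightIdx h)} (hw : IsOrdered WeightIdx.parity w) :
    w = w.filter (fun i => ¬ IsBorel π i) ++ w.filter (fun i => IsBorel π i) := by
  have hp : w.Perm (w.filter (fun i => ¬ IsBorel π i) ++ w.filter (fun i => IsBorel π i)) := by
    refine ((List.filter_append_perm (fun i => decide (IsBorel π i)) w).symm.trans
      List.perm_append_comm).trans ?_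
    simp
  refine hp.eq_of_pairwise' hw.sorted ?_
  refine List.pairwise_append.mpr ⟨hw.sorted.sublist List.filter_sublist,
    hw.sorted.sublist List.filter_sublist, fun i hi j hj => (hord i j ?_ ?_).le⟩
  · simpa using (List.mem_filter.mp hi).2
  · simpa using (List.mem_filter.mp hj).2

/-- The left ideal that defines the Verma module lies in the span of the ordered words that contain
a letter from the Borel subalgebra. -/
theorem mem_span_of_mem_vermaIdeal (hπ : LinearIndepOn ℂ id π) {u : Env l}
    (hu : u ∈ vermaIdeal h π lam) :
    u ∈ Submodule.span ℂ
      (word (shiftedGen lam) '' {w | IsOrdered WeightIdx.parity w ∧ ∃ i ∈ w, IsBorel π i}) := by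
  classical
  set K := Submodule.span ℂ
      (word (shiftedGen lam) '' {w | IsOrdered WeightIdx.parity w ∧ ∃ i ∈ w, IsBorel π i}) with hK
  let zB := fun k : {i : WeightIdx h // IsBorel π i} => shiftedGen lam k.1
  have hzB : ∀ v, word zB v = word (shiftedGen lam) (v.map Subtype.val) := by
    intro v
    simp [word, zB]
  have hword : ∀ w, IsOrdered WeightIdx.parity w → ∀ i, IsBorel π i →
      word (shiftedGen lam) w * shiftedGen lam i ∈ K := by
    intro w hw i hi
    set y := w.filter (fun i => ¬ IsBorel π i) with hy
    have hsplit := hw.eq_filter_append hord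
    rw [← hy] at hsplit
    obtain ⟨b, hb⟩ : ∃ b : List {i : WeightIdx h // IsBorel π i},
        b.map Subtype.val = w.filter (fun i => IsBorel π i) := by
      have h1 : ∀ i ∈ w.filter (fun i => IsBorel π i), IsBorel π i := fun i hi => by
        simpa using (List.mem_filter.mp hi).2
      exact ⟨(w.filter (fun i => IsBorel π i)).attach.map fun i => ⟨i.1, h1 i.1 i.2⟩, by
        simp [Function.comp_def]⟩
    have h1 : word zB (b ++ [⟨i, hi⟩]) ∈ Submodule.span ℂ
        (word zB '' {v | IsOrdered (fun k => k.1.parity) v ∧ 1 ≤ v.length}) :=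
      wordSpan_le_ordered _ zB (m := 1) (shiftedGen_supercomm_mem lam hπ) _
        (word_mem_wordSpan _ (by simp) (Nat.lt_succ_self _))
    have h2 : word (shiftedGen lam) w * shiftedGen lam i =
        word (shiftedGen lam) y * word zB (b ++ [⟨i, hi⟩]) := by
      rw [hzB, List.map_append, hb, word_append, ← mul_assoc, ← word_append, ← hsplit]
      simp
    rw [h2]
    generalize word zB (b ++ [⟨i, hi⟩]) = t at h1
    induction h1 using Submodule.span_induction with
    | mem x hx =>
      obtain ⟨v, ⟨hv, hv1⟩, rfl⟩ := hx
      rw [hzB, ← word_append]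
      refine Submodule.subset_span ⟨_, ⟨?_, ?_⟩, rfl⟩
      · refine List.pairwise_append.mpr ⟨List.Pairwise.sublist List.filter_sublist hw, ?_, ?_⟩
        · rw [List.pairwise_map]
          refine hv.imp ?_
          rintro a c (h3 | ⟨rfl, h3⟩)
          · exact .inl h3
          · exact .inr ⟨rfl, h3⟩
        · intro a ha c hc
          obtain ⟨k, -, rfl⟩ := List.mem_map.mp hc
          exact .inl (hord _ _ (by simpa using (List.mem_filter.mp ha).2) k.2)
      · obtain ⟨k, t, rfl⟩ := List.exists_cons_of_length_pos hv1
        exact ⟨k.1, by simp, k.2⟩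
    | zero => rw [mul_zero]; exact zero_mem _
    | add x x' _ _ hx hx' => rw [mul_add]; exact add_mem hx hx'
    | smul c x _ hx => rw [mul_smul_comm]; exact Submodule.smul_mem _ _ hx
  have hmul : ∀ a i, IsBorel π i → a * shiftedGen lam i ∈ K := by
    intro a i hi
    have ha := mem_span_ordered lam a
    induction ha using Submodule.span_induction with
    | mem x hx =>
      obtain ⟨w, hw, rfl⟩ := hx
      exact hword w hw i hi
    | zero => rw [zero_mul]; exact zero_mem _
    | add x x' _ _ hx hx' => rw [add_mul]; exact add_mem hx hx'
    | smul c x _ hx => rw [smul_mul_assoc]; exact Submodule.smul_mem _ _ hx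
  have hu' : ∀ u ∈ Ideal.span (shiftedGen lam '' {i | IsBorel π i}), ∀ a : Env l, a * u ∈ K := by
    intro u hu
    induction hu using Submodule.span_induction with
    | mem x hx =>
      obtain ⟨i, hi, rfl⟩ := hx
      exact fun a => hmul a i hi
    | zero => intro a; rw [mul_zero]; exact zero_mem _
    | add x x' _ _ hx hx' => intro a; rw [mul_add]; exact add_mem (hx a) (hx' a)
    | smul c x _ hx => intro a; rw [smul_eq_mul, ← mul_assoc]; exact hx (a * c)
  simpa using hu' u (vermaIdeal_le lam hu) 1

/-- The ordered words without letters from the Borel subalgebra are linearly independent in the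
Verma module. -/
theorem independent_mod_vermaIdeal (hl : 1 ≤ l) (hπ : LinearIndepOn ℂ id π)
    (S : Finset (List (WeightIdx h))) (hS : ∀ v ∈ S, IsOrdered WeightIdx.parity v ∧ ∀ i ∈ v, ¬ IsBorel π i)
    (d : List (WeightIdx h) → ℂ)
    (hd : ∑ v ∈ S, d v • word (shiftedGen lam) v ∈ vermaIdeal h π lam) : ∀ v ∈ S, d v = 0 := by
  have hli : LinearIndepOn ℂ (word (shiftedGen lam)) {w : List (WeightIdx h) | IsOrdered WeightIdx.parity w} :=
    linearIndependent_shifted lam hl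
  have h1 := mem_span_of_mem_vermaIdeal lam hord hπ hd
  have h2 : ∑ v ∈ S, d v • word (shiftedGen lam) v ∈ Submodule.span ℂ
      (word (shiftedGen lam) '' {w | IsOrdered WeightIdx.parity w ∧ ∀ i ∈ w, ¬ IsBorel π i}) :=
    Submodule.sum_mem _ fun v hv => Submodule.smul_mem _ _ (Submodule.subset_span ⟨v, hS v hv, rfl⟩)
  have hdisj := LinearIndependent.disjoint_span_image hli
    (s := {w | ∀ i ∈ w.1, ¬ IsBorel π i}) (t := {w | ∃ i ∈ w.1, IsBorel π i}) (by
      rw [Set.disjoint_left]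
      rintro w hw ⟨i, hi, hb⟩
      exact hw i hi hb)
  have e1 : (fun w : {w : List (WeightIdx h) | IsOrdered WeightIdx.parity w} => word (shiftedGen lam) w.1) ''
      {w | ∀ i ∈ w.1, ¬ IsBorel π i} =
      word (shiftedGen lam) '' {w | IsOrdered WeightIdx.parity w ∧ ∀ i ∈ w, ¬ IsBorel π i} := by
    ext y
    constructor
    · rintro ⟨w, hw, rfl⟩; exact ⟨w.1, ⟨w.2, hw⟩, rfl⟩
    · rintro ⟨w, hw, rfl⟩; exact ⟨⟨w, hw.1⟩, hw.2, rfl⟩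
  have e2 : (fun w : {w : List (WeightIdx h) | IsOrdered WeightIdx.parity w} => word (shiftedGen lam) w.1) ''
      {w | ∃ i ∈ w.1, IsBorel π i} =
      word (shiftedGen lam) '' {w | IsOrdered WeightIdx.parity w ∧ ∃ i ∈ w, IsBorel π i} := by
    ext y
    constructor
    · rintro ⟨w, hw, rfl⟩; exact ⟨w.1, ⟨w.2, hw⟩, rfl⟩
    · rintro ⟨w, hw, rfl⟩; exact ⟨⟨w, hw.1⟩, hw.2, rfl⟩
  rw [e1, e2] at hdisj
  have h0 := Submodule.disjoint_def.mp hdisj _ h2 h1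
  exact linearIndepOn_iff'.mp hli S d (fun v hv => (hS v hv).1) h0

end Order

end Osp

namespace Osp

/-! ### Polynomial dependence on the highest weight -/

variable {l : ℕ} {h : LieSubalgebra ℂ (even l)} [h.IsCartanSubalgebra]
  {π : Set (Module.Dual ℂ h)} (lam : Module.Dual ℂ h)

/-- In the Verma module, a word in the Borel subalgebra acts on the highest weight vector by the
product of the values of `lam` at its letters. -/
theorem word_sub_prod_mem_vermaIdeal (b : List (WeightIdx h)) (hb : ∀ i ∈ b, IsBorel π i) :
    word (shiftedGen 0) b - (b.map fun i => lam (cartanElt i)).prod • (1 : Env l) ∈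
      vermaIdeal h π lam := by
  induction b with
  | nil => simp
  | cons i t ih =>
    have h1 := ih fun j hj => hb j (List.mem_cons_of_mem _ hj)
    have h2 := shiftedGen_mem_vermaIdeal lam (hb i (by simp))
    have h3 : shiftedGen lam i = shiftedGen 0 i - lam (cartanElt i) • (1 : Env l) := by
      simp [shiftedGen, Algebra.algebraMap_eq_smul_one]
    have h4 := add_mem (Ideal.mul_mem_left _ (shiftedGen 0 i) h1)
      (Submodule.smul_of_tower_mem _ (t.map fun i => lam (cartanElt i)).prod h2)
    convert! h4 using 1
    rw [h3, word_cons, List.map_cons, List.prod_cons, mul_sub, mul_smul_comm, mul_one]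
    module

omit [h.IsCartanSubalgebra] in
theorem word_shiftedGen_eq {v : List (WeightIdx h)} (hv : ∀ i ∈ v, ¬ IsBorel π i) :
    word (shiftedGen 0) v = word (shiftedGen lam) v := by
  unfold word
  congr 1
  refine List.map_congr_left fun i hi => ?_
  have hi' := weight_ne_zero_of_not_isBorel (hv i hi)
  rw [shiftedGen_of_ne 0 hi', shiftedGen_of_ne lam hi']

omit [h.IsCartanSubalgebra] in
/-- A linear order in which the basis vectors outside the Borel subalgebra come first. -/
theorem exists_linearOrder_isBorel (π : Set (Module.Dual ℂ h)) :
    ∃ _ : LinearOrder (WeightIdx h), ∀ i j : WeightIdx h, ¬ IsBorel π i → IsBorel π j → i < j := by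
  classical
  let _ : LinearOrder (WeightIdx h) := IsWellOrder.linearOrder WellOrderingRel
  let f : WeightIdx h → ℕ ×ₗ WeightIdx h := fun i => toLex (if IsBorel π i then 1 else 0, i)
  have hf : Function.Injective f := fun i j hij => (Prod.ext_iff.mp (toLex.injective hij)).2
  refine ⟨LinearOrder.lift' f hf, fun i j hi hj => ?_⟩
  change f i < f j
  rw [Prod.Lex.lt_iff]
  left
  simp [f, hi, hj]

/-- The condition that an element of the enveloping algebra annihilates the highest weight vector
of the Verma module is polynomial in the highest weight. -/
theorem exists_polynomials_mem_vermaIdeal (hl : 1 ≤ l) (hπ : LinearIndepOn ℂ id π) (u : Env l) :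
    ∃ F : Set (MvPolynomial (Module.Dual ℂ (Module.Dual ℂ h)) ℂ), ∀ lam : Module.Dual ℂ h,
      u ∈ vermaIdeal h π lam ↔
        ∀ P ∈ F, MvPolynomial.eval (fun φ : Module.Dual ℂ (Module.Dual ℂ h) => φ lam) P = 0 := by
  classical
  obtain ⟨_, hord⟩ := exists_linearOrder_isBorel π
  obtain ⟨a, ha, rfl⟩ := (Finsupp.mem_span_image_iff_linearCombination ℂ).mp
    (mem_span_ordered (0 : Module.Dual ℂ h) u)
  have hord' : ∀ w ∈ a.support, IsOrdered WeightIdx.parity w := fun w hw => ha hw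
  let y (w : List (WeightIdx h)) := w.filter fun i => ¬ IsBorel π i
  let b (w : List (WeightIdx h)) := w.filter fun i => IsBorel π i
  have hy : ∀ w, ∀ i ∈ y w, ¬ IsBorel π i := fun w i hi => by
    simpa using (List.mem_filter.mp hi).2
  have hb : ∀ w, ∀ i ∈ b w, IsBorel π i := fun w i hi => by
    simpa using (List.mem_filter.mp hi).2
  -- The coefficient, in the Verma module, of a word without letters from the Borel subalgebra.
  let P (v : List (WeightIdx h)) : MvPolynomial (Module.Dual ℂ (Module.Dual ℂ h)) ℂ :=
    ∑ w ∈ a.support with y w = v, MvPolynomial.C (a w) *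
      ((b w).map fun i => MvPolynomial.X (Module.Dual.eval ℂ h (cartanElt i))).prod
  refine ⟨P '' (a.support.image y), fun lam => ?_⟩
  set ev := MvPolynomial.eval fun φ : Module.Dual ℂ (Module.Dual ℂ h) => φ lam
  have hP : ∀ v, ev (P v) = ∑ w ∈ a.support with y w = v,
      a w * ((b w).map fun i => lam (cartanElt i)).prod := by
    intro v
    simp only [P, map_sum, map_mul, ev, MvPolynomial.eval_C, map_list_prod, List.map_map,
      Function.comp_def, MvPolynomial.eval_X, Module.Dual.eval_apply]
  have hred : Finsupp.linearCombination ℂ (word (shiftedGen 0)) a -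
      ∑ v ∈ a.support.image y, ev (P v) • word (shiftedGen lam) v ∈ vermaIdeal h π lam := by
    have e1 : ∑ v ∈ a.support.image y, ev (P v) • word (shiftedGen lam) v =
        ∑ w ∈ a.support, (a w * ((b w).map fun i => lam (cartanElt i)).prod) •
          word (shiftedGen lam) (y w) := by
      rw [← Finset.sum_fiberwise_of_maps_to
        (fun w hw => Finset.mem_image_of_mem y hw) (fun w => _ • word (shiftedGen lam) (y w))]
      refine Finset.sum_congr rfl fun v _ => ?_
      rw [hP, Finset.sum_smul]
      refine Finset.sum_congr rfl fun w hw => ?_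
      rw [(Finset.mem_filter.mp hw).2]
    rw [e1, Finsupp.linearCombination_apply, Finsupp.sum, ← Finset.sum_sub_distrib]
    refine Submodule.sum_mem _ fun w hw => ?_
    have e2 : word (shiftedGen 0) w = word (shiftedGen lam) (y w) * word (shiftedGen 0) (b w) := by
      conv_lhs => rw [(hord' w hw).eq_filter_append hord]
      rw [word_append, word_shiftedGen_eq lam (hy w)]
    have e3 := Submodule.smul_of_tower_mem _ (a w) (Ideal.mul_mem_left _
      (word (shiftedGen lam) (y w)) (word_sub_prod_mem_vermaIdeal lam (b w) (hb w)))
    convert! e3 using 1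
    rw [e2, mul_sub, mul_smul_comm, mul_one, mul_smul]
    module
  constructor
  · rintro hu _ ⟨v, hv, rfl⟩
    have h1 := sub_mem hu hred
    rw [sub_sub_cancel] at h1
    refine independent_mod_vermaIdeal lam hord hl hπ _ (fun v hv => ?_) _ h1 v hv
    obtain ⟨w, hw, rfl⟩ := Finset.mem_image.mp hv
    exact ⟨List.Pairwise.sublist List.filter_sublist (hord' w hw), hy w⟩
  · intro hF
    have h1 : ∑ v ∈ a.support.image y, ev (P v) • word (shiftedGen lam) v = 0 :=
      Finset.sum_eq_zero fun v hv => by rw [hF _ ⟨v, hv, rfl⟩, zero_smul]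
    rwa [h1, sub_zero] at hred

end Osp

end

theorem mainTheorem8 (l : ℕ) (hl : 1 ≤ l)
    (h : LieSubalgebra ℂ (Osp.even l)) (hh : h.IsCartanSubalgebra)
    (π : Set (Module.Dual ℂ h)) (hπ : Osp.IsSimpleRoots h π)
    (V : Submodule ℂ (Osp.Env l)) (hV : Osp.AdInvariant V) :
    Osp.IsZariskiClosed
      {lam : Module.Dual ℂ h |
        (V : Set (Osp.Env l)) ⊆ Module.annihilator (Osp.Env l) (Osp.Verma h π lam)} := by
  choose F hF using Osp.exists_polynomials_mem_vermaIdeal hl hπ.linearIndepOn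
  refine ⟨⋃ v ∈ V, F v, ?_⟩
  ext lam
  rw [Set.mem_ofPred_eq, Osp.subset_annihilator_iff π lam hV]
  constructor
  · intro h1 P hP
    obtain ⟨v, hv, hP⟩ := Set.mem_iUnion₂.mp hP
    exact (hF v lam).mp (h1 v hv) P hP
  · intro h1 v hv
    exact (hF v lam).mpr fun P hP => h1 P (Set.mem_iUnion₂.mpr ⟨v, hv, hP⟩)
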